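/- For every sample size $n$ consider the multiphase regression model $$y_i=\sum_{j=1}^{N+1}x_i^T\beta^0_{(j-1)}\mathbf 1[\tau^0_{j-1}<w_i\le\tau^0_j]+\varepsilon_i,\qquad i=1,\dots,n,$$ with $N\ge 0$, $-\infty=\tau^0_0<\tau^0_1<\dots<\tau^0_N<\tau^0_{N+1}=\infty$, $x_i,\beta^0_{(j)}\in\mathbb R^p$; here $p$, $N$, $\tau^0$, $\beta^0$, the distributions, and the quantities $s,\check N,\check\tau,l_{\min}$ below may all depend on $n$. Let $\Phi$ be the cdf of $w_i$ and $d(a,b)=|\Phi(b)-\Phi(a)|$. For $N\ge1$ let $\xi_{\max}$ and $\xi_{\min}$ be the maximum and the minimum over $1\le j\le N$ of $\|\beta^0_{(j)}-\beta^0_{(j-1)}\|_2$, and $\rho=\xi_{\max}/\xi_{\min}$; for $N=0$ put $\xi_{\max}=0$, $\rho=1$. Assume: (A) (initializers) $\check N\ge 1\vee N$, $\check N\le c_N(1\vee N)$ for a constant $c_N\ge1$; $\check\tau_1\le\dots\le\check\tau_{\check N}$ are real, and with $\check\tau_0=-\infty$, $\check\tau_{\check N+1}=\infty$ one has $d(\check\tau_{j-1},\check\tau_j)>l_{\min}>0$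 for $j=1,\dots,\check N+1$; with $\check u_n=1\wedge c_u(1/n)^{1/k}$ for constants $k\in[1,\infty)$, $c_u>0$, there are indices $0=m_0<m_1<\dots<m_N<m_{N+1}=\check N+1$, forming a set $\mathcal T$, such that $d(\check\tau_{m_j},\tau^0_j)\le\check u_n$ for $j=1,\dots,N$. (B) The set $S$ of coordinates in which at least one of $\beta^0_{(0)},\dots,\beta^0_{(N)}$ is non-zero satisfies $|S|\le s$, $s\ge1$, and $s\log p/(n\,l_{\min}^2)\to0$. (C) If $N\ge1$: $\xi_{\min}>0$, and $d(\tau^0_{j-1},\tau^0_j)\ge c_S\,l_{\min}$ for $j=1,\dots,N$ with a constant $c_S>0$. Moreover $N\rho\,\check u_n/l_{\min}\to0$. (D) All $x_i,w_i,\varepsilon_i$ are independent; the $x_i$ are identically distributed, mean zero, subgaussian with variance parameter at most $C$, and the eigenvalues of $E\,x_ix_i^T$ lie in $[\kappa,\phi]$, $0<\kappa\le\phi<\infty$; the $\varepsilon_i$ are identically distributed, mean zero, subgaussian with variance parameter at most $C$; the $w_i$ are identically distributed. (E) For a constant $c_H$ and all large $n$, $\xi_{\max}\sqrt{\log p/n}\le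 c_H$ or $\log p/n\le c_H\,\check u_n$. For $j=1,\dots,\check N+1$ let $\hat\alpha_{(j-1)}$ be a solution of the Lasso $$\min_{\alpha\in\mathbb R^p}\ \frac1n\sum_{i=1}^n(y_i-x_i^T\alpha)^2\,\mathbf 1[\check\tau_{j-1}<w_i\le\check\tau_j]+\lambda_0\|\alpha\|_1 ,\qquad \lambda_0=A\max\Big\{\sqrt{\log p/n},\ \xi_{\max}\check u_n\Big\}.$$ There is $A_0>0$ such that for every $A\ge A_0$ there are $c,c_1,c_2>0$ for which the following holds for all $n$ sufficiently large and $q=1,2$; $A_0$ depends only on $C,\kappa,\phi,c_H$, and $c,c_1,c_2$ depend only on these and on $A$. (i) For each $j=1,\dots,N+1$, with probability at least $1-c_1\exp(-c_2\log p)$, $$\|\hat\alpha_{(m_j-1)}-\beta^0_{(j-1)}\|_q\le c\,s^{1/q}\max\Big\{\sqrt{\log p/n},\ \xi_{\max}\check u_n\Big\}\Big/l_{\min}.$$ (ii) For each $j\in\{0,\dots,\check N+1\}\setminus\mathcal T$ there is a first index $k_j\in\{1,\dots,N+1\}$ with $\tau^0_{k_j-1}<\check\tau_j\le\tau^0_{k_j}$,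 and with probability at least $1-c_1\exp(-c_2\log p)$, $$\|\hat\alpha_{(j-1)}-\beta^0_{(k_j-1)}\|_q\le c\,s^{1/q}\max\Big\{\sqrt{\log p/n},\ \xi_{\max}\check u_n\Big\}\Big/l_{\min}.$$ -/

import Mathlib

open Filter Topology MeasureTheory ProbabilityTheory

noncomputable section

namespace ChangePoint

/-- The `ℓ_q` norm `(∑ |v_k|^q)^(1/q)` of a vector in `ℝ^p`. -/
def lqNorm {p : ℕ} (q : ℝ) (v : Fin p → ℝ) : ℝ := (∑ k, |v k| ^ q) ^ (1 / q)

/-- `(τ_1, …, τ_K)` extended to `(τ_0, τ_1, …, τ_K, τ_{K+1})` with `τ_0 = -∞`, `τ_{K+1} = ∞`. -/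
def extendGrid {K : ℕ} (τ : Fin K → ℝ) : Fin (K + 2) → EReal :=
  Fin.cons ⊥ (Fin.snoc (α := fun _ => EReal) (fun i => (τ i : EReal)) ⊤)

/-- The cdf `Φ(t) = P(w ≤ t)` of a law `ν` on `ℝ`, at an extended real number `t`. -/
def cdfE (ν : Measure ℝ) (t : EReal) : ℝ := ν.real {u : ℝ | (u : EReal) ≤ t}

/-- The distance in the cdf scale; for `a ≤ b` it is `Φ(b) - Φ(a) = P(a < w ≤ b)`. -/
def cdfDist (ν : Measure ℝ) (a b : EReal) : ℝ := |cdfE ν b - cdfE ν a|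

open Classical in
/-- The indicator `1[a < t ≤ b]`. -/
def segInd (a b : EReal) (t : ℝ) : ℝ := if a < (t : EReal) ∧ (t : EReal) ≤ b then 1 else 0

/-- The least squares loss `Q*(γ, a, b) = ∑ (y_i - x_iᵀγ)² 1[a < w_i ≤ b]` of a segment. -/
def segLoss {n p : ℕ} (y : Fin n → ℝ) (x : Fin n → Fin p → ℝ) (w : Fin n → ℝ)
    (γ : Fin p → ℝ) (a b : EReal) : ℝ :=
  ∑ i, (y i - x i ⬝ᵥ γ) ^ 2 * segInd a b (w i)

/-- `γ` is a solution of the Lasso `min (1/n) Q*(γ, a, b) + lam ‖γ‖₁`. -/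
def IsLasso {n p : ℕ} (y : Fin n → ℝ) (x : Fin n → Fin p → ℝ) (w : Fin n → ℝ)
    (a b : EReal) (lam : ℝ) (γ : Fin p → ℝ) : Prop :=
  ∀ γ' : Fin p → ℝ,
    1 / (n : ℝ) * segLoss y x w γ a b + lam * lqNorm 1 γ ≤
      1 / (n : ℝ) * segLoss y x w γ' a b + lam * lqNorm 1 γ'

/-- Everything that is given at sample size `n`: the model, the random sample, and the
initializers. A family indexed by `Fin (N + 1)` has the indices
`0, …, N`. -/
structure Setup (n : ℕ) where
  /-- number of predictors -/
  p : ℕ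
  /-- sparsity level -/
  s : ℕ
  /-- number of change points -/
  N : ℕ
  /-- true change points, distinct and finite -/
  τ₀ : Fin N → ℝ
  strictMono_τ₀ : StrictMono τ₀
  /-- true regression coefficients `β⁰_(0), …, β⁰_(N)` -/
  β₀ : Fin (N + 1) → Fin p → ℝ
  /-- sample space -/
  Ω : Type*
  [mΩ : MeasurableSpace Ω]
  /-- probability -/
  P : Measure Ω
  [isProb : IsProbabilityMeasure P]
  /-- predictors, change inducing variables, model errors -/
  x : Fin n → Ω → Fin p → ℝ
  w : Fin n → Ω → ℝ
  ε : Fin n → Ω → ℝ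
  /-- the common laws of the `x_i`, of the `w_i` and of the `ε_i` -/
  lawX : Measure (Fin p → ℝ)
  lawW : Measure ℝ
  lawE : Measure ℝ
  /-- number of initial change points -/
  Ncheck : ℕ
  /-- initial change points -/
  τcheck : Fin Ncheck → ℝ
  monotone_τcheck : Monotone τcheck
  /-- the indices `m_0, …, m_{N+1}` in `{0, …, Ncheck + 1}` that make up the set `𝒯` -/
  m : Fin (N + 2) → Fin (Ncheck + 2)
  /-- minimal separation -/
  lmin : ℝ

attribute [instance] Setup.mΩ Setup.isProb

namespace Setup

variable {n : ℕ} (M : Setup n)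

/-- The responses `y_i = ∑_{j=1}^{N+1} x_iᵀ β⁰_(j-1) 1[τ⁰_{j-1} < w_i ≤ τ⁰_j] + ε_i`. -/
def y (i : Fin n) (ω : M.Ω) : ℝ :=
  ∑ j : Fin (M.N + 1), (M.x i ω ⬝ᵥ M.β₀ j) *
    segInd (extendGrid M.τ₀ j.castSucc) (extendGrid M.τ₀ j.succ) (M.w i ω) + M.ε i ω

/-- The size of the jump at the `j`-th change point. -/
def jump (j : Fin M.N) : ℝ := lqNorm 2 (M.β₀ j.succ - M.β₀ j.castSucc)

/-- Maximum jump size (it is `0` if there is no change point). -/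
def ξmax : ℝ := ⨆ j, M.jump j

/-- Minimum jump size (only used if there is a change point). -/
def ξmin : ℝ := ⨅ j, M.jump j

/-- Ratio of the jump sizes, `1` if there is no change point. -/
def ρ : ℝ := if M.N = 0 then 1 else M.ξmax / M.ξmin

/-- Distance in the scale of the cdf of the change inducing variable. -/
def d (a b : EReal) : ℝ := cdfDist M.lawW a b

/-- The set `S` of all coordinates in which some coefficient vector is non-zero. -/
def S : Set (Fin M.p) := {l | ∃ j, M.β₀ j l ≠ 0}

/-- The neighbourhood size `1 ∧ c (1/n)^(1/k)` of the initializers; `M` only supplies `n`. -/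
def ucheck (_ : Setup n) (c k : ℝ) : ℝ := min 1 (c * (1 / (n : ℝ)) ^ (1 / k))

/-- `max {√(log p / n), ξ_max ǔ_n}`. -/
def rate (c k : ℝ) : ℝ := max √(Real.log M.p / n) (M.ξmax * M.ucheck c k)

/-- The requirements on the initializers. -/
structure ConditionA (cN c k : ℝ) : Prop where
  max_le_Ncheck : max 1 M.N ≤ M.Ncheck
  Ncheck_le : (M.Ncheck : ℝ) ≤ cN * max 1 (M.N : ℝ)
  lmin_pos : 0 < M.lmin
  separated : ∀ j : Fin (M.Ncheck + 1),
    M.lmin < M.d (extendGrid M.τcheck j.castSucc) (extendGrid M.τcheck j.succ)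
  m_strictMono : StrictMono M.m
  m_zero : M.m 0 = 0
  m_last : M.m (Fin.last (M.N + 1)) = Fin.last (M.Ncheck + 1)
  close : ∀ j : Fin M.N,
    M.d (extendGrid M.τcheck (M.m j.castSucc.succ)) (extendGrid M.τ₀ j.castSucc.succ) ≤ M.ucheck c k

/-- Sparsity. -/
structure Sparse : Prop where
  one_le_s : 1 ≤ M.s
  card_le : M.S.ncard ≤ M.s

/-- Non-degenerate jumps, and separation of the change points
(`d(τ⁰_{j-1}, τ⁰_j) ≥ c l_min` for `j = 1, …, N`). Empty if there is no change point. -/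
structure SeparatedChanges (c : ℝ) : Prop where
  jump_pos : ∀ j, 0 < M.jump j
  separated : ∀ j : Fin M.N,
    c * M.lmin ≤ M.d (extendGrid M.τ₀ j.castSucc.castSucc) (extendGrid M.τ₀ j.castSucc.succ)

/-- The covariance matrix `E x xᵀ` of the predictors. -/
def Sig : Matrix (Fin M.p) (Fin M.p) ℝ := fun a b => ∫ v, v a * v b ∂M.lawX

/-- The distributional assumptions, with bound `C` on the variance parameters and bounds
`κ`, `φ` on the smallest and on the largest eigenvalue of `Sig` (through the quadratic form).
The three `indep` fields together say that all the `x_i`, `w_i`, `ε_i` are independent. -/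
structure ConditionD (C : NNReal) (κ φ : ℝ) : Prop where
  measurable_x : ∀ i, Measurable (M.x i)
  measurable_w : ∀ i, Measurable (M.w i)
  measurable_ε : ∀ i, Measurable (M.ε i)
  law_x : ∀ i, M.P.map (M.x i) = M.lawX
  law_w : ∀ i, M.P.map (M.w i) = M.lawW
  law_ε : ∀ i, M.P.map (M.ε i) = M.lawE
  indep_obs : iIndepFun (fun i ω => (M.x i ω, M.w i ω, M.ε i ω)) M.P
  indep_x : ∀ i, IndepFun (M.x i) (fun ω => (M.w i ω, M.ε i ω)) M.P
  indep_w_ε : ∀ i, IndepFun (M.w i) (M.ε i) M.P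
  mean_x : ∀ l, ∫ v, v l ∂M.lawX = 0
  mean_ε : ∫ e, e ∂M.lawE = 0
  subgaussian_x : ∀ u : Fin M.p → ℝ, lqNorm 2 u = 1 →
    HasSubgaussianMGF (fun v : Fin M.p → ℝ => v ⬝ᵥ u) C M.lawX
  subgaussian_ε : HasSubgaussianMGF (fun e : ℝ => e) C M.lawE
  le_eigen : ∀ u : Fin M.p → ℝ, κ * lqNorm 2 u ^ 2 ≤ u ⬝ᵥ M.Sig.mulVec u
  eigen_le : ∀ u : Fin M.p → ℝ, u ⬝ᵥ M.Sig.mulVec u ≤ φ * lqNorm 2 u ^ 2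

/-- `α̂_(0), …, α̂_(Ncheck)` are initial Lasso estimates with tuning parameter `lam`: the
estimate `α̂_(j-1)` is a (random) Lasso solution on the segment `(τcheck_{j-1}, τcheck_j]`. -/
def IsStepZero (lam : ℝ) (α : Fin (M.Ncheck + 1) → M.Ω → Fin M.p → ℝ) : Prop :=
  ∀ j ω, IsLasso (fun i => M.y i ω) (fun i => M.x i ω) (fun i => M.w i ω)
    (extendGrid M.τcheck j.castSucc) (extendGrid M.τcheck j.succ) lam (α j ω)

/-- With probability at least `1 - c₁ exp(-c₂ log p)`, the error `‖α - β‖_q` is at most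
`c s^(1/q) r / l_min`. (The exceptional event is bounded in outer measure, so that nothing has
to be known about the measurability of `α`.) -/
def ErrorBound (c c₁ c₂ r q : ℝ) (α : M.Ω → Fin M.p → ℝ) (β : Fin M.p → ℝ) : Prop :=
  M.P {ω | ¬ lqNorm q (α ω - β) ≤ c * (M.s : ℝ) ^ (1 / q) * r / M.lmin} ≤
    ENNReal.ofReal (c₁ * Real.exp (-c₂ * Real.log M.p))

/-- `l + 1` is the first index `k` in `{1, …, N+1}` with `τ⁰_{k-1} < τcheck_j ≤ τ⁰_k`. -/
def IsSegmentOf (j : Fin (M.Ncheck + 2)) (l : Fin (M.N + 1)) : Prop :=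
  IsLeast {l : Fin (M.N + 1) | extendGrid M.τ₀ l.castSucc < extendGrid M.τcheck j ∧
    extendGrid M.τcheck j ≤ extendGrid M.τ₀ l.succ} l

end Setup

end ChangePoint

end

noncomputable section

namespace ChangePoint

/-! ### Exponential moments and the Chernoff bound. -/

section Moments

variable {Ω : Type*} [MeasurableSpace Ω] {P : Measure Ω}

/-! Each initial segment runs between two consecutive matched initializers. There the regression
vector is a single `β⁰`, except on at most two end pieces of mass at most `ǔ_n`, where it is off by
one jump (`Interlaced.nearlyConstant`). So every `α̂` is a Lasso in a slightly misspecified linear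
model, and (i) and (ii) are the same estimate. In (ii) the interlacing also identifies the true
segment that contains the initializer (`Interlaced.isSegmentOf`).

The Lasso bound itself is deterministic (`lasso_error_bound`). It needs the score at `β⁰` to be at
most a quarter of the penalty level, and a restricted eigenvalue on the cone where the `ℓ₁` mass is
at most four times that on `S`.

The score splits into noise and misspecification. The noise is of order `√(log p / n)` by a
Bernstein bound. Each end piece contributes at most `ξ_max (ǔ_n + 2 log p / n) / a`, because the
exponential moment of a variable restricted to a set keeps the mass of that set as a factor; (E)
absorbs the term `ξ_max log p / n` into the rate.

The restricted eigenvalue is proved for sums of `k` signed basis vectors, by a lower tail bound and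
a union over `(3p)^k` choices. Maurey's empirical method extends it to all vectors at a cost of
order `‖v‖₁² / (k - 1)` (`gram_lower_bound`). On the cone `‖v‖₁² ≤ 16 s ‖v‖₂²`, so `k - 1` a large
multiple of `s` suffices, and the sparsity condition pays for the union.
`ConditionD.exists_good_event` collects the random part and `ConditionD.errorBound` combines it with
the deterministic one. -/

theorem lintegral_exp_sq_gaussian :
    ∫⁻ g, ENNReal.ofReal (Real.exp (g ^ 2 / 4)) ∂(gaussianReal 0 1) ≤ 2 := by
  rw [gaussianReal_of_var_ne_zero _ one_ne_zero,
    lintegral_withDensity_eq_lintegral_mul _ (measurable_gaussianPDF _ _) (by fun_prop)]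
  have h : ∀ g : ℝ, (gaussianPDF 0 1 * fun g => ENNReal.ofReal (Real.exp (g ^ 2 / 4))) g =
      ENNReal.ofReal ((√(2 * Real.pi))⁻¹ * Real.exp (-(1 / 4) * g ^ 2)) := by
    intro g
    rw [Pi.mul_apply, gaussianPDF, ← ENNReal.ofReal_mul (gaussianPDFReal_nonneg _ _ _),
      gaussianPDFReal, mul_assoc, ← Real.exp_add]
    congr 3
    · simp
    · push_cast; ring_nf
  simp_rw [h]
  rw [← ofReal_integral_eq_lintegral_ofReal, integral_const_mul, integral_gaussian]
  · rw [← Real.sqrt_inv, ← Real.sqrt_mul (by positivity)]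
    have : (2 * Real.pi)⁻¹ * (Real.pi / (1 / 4)) = 2 := by field_simp; norm_num
    rw [this]
    have h2 : √2 ≤ 2 := by
      rw [Real.sqrt_le_left (by norm_num)]; norm_num
    calc ENNReal.ofReal √2 ≤ ENNReal.ofReal 2 := ENNReal.ofReal_le_ofReal h2
      _ = 2 := by simp
  · exact (integrable_exp_neg_mul_sq (by norm_num)).const_mul _
  · exact Eventually.of_forall fun _ => by positivity

theorem integrable_of_lintegral_ofReal_le {f : Ω → ℝ} (hf : Measurable f) (h0 : ∀ ω, 0 ≤ f ω)
    {b : ℝ} (hb : 0 ≤ b) (h : ∫⁻ ω, ENNReal.ofReal (f ω) ∂P ≤ ENNReal.ofReal b) :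
    Integrable f P ∧ ∫ ω, f ω ∂P ≤ b := by
  have hi : Integrable f P := by
    refine ⟨hf.aestronglyMeasurable, ?_⟩
    rw [hasFiniteIntegral_iff_ofReal (Eventually.of_forall h0)]
    exact h.trans_lt ENNReal.ofReal_lt_top
  refine ⟨hi, ?_⟩
  rw [← ofReal_integral_eq_lintegral_ofReal hi (Eventually.of_forall h0)] at h
  exact (ENNReal.ofReal_le_ofReal_iff hb).1 h

/-- `E exp(a U²) ≤ 2`, with integrability. -/
def ExpSq (P : Measure Ω) (a : ℝ) (U : Ω → ℝ) : Prop :=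
  Integrable (fun ω => Real.exp (a * U ω ^ 2)) P ∧ ∫ ω, Real.exp (a * U ω ^ 2) ∂P ≤ 2

/-- Gaussian linearization: `exp(a U²)` is the mean of `exp(√(2a) g U)` over a standard normal `g`.
After exchanging the integrals, the subgaussian bound leaves `exp(a C g²) ≤ exp(g² / 4)`, whose mean
is `√2`. -/
theorem expSq_of_hasSubgaussianMGF [IsProbabilityMeasure P]
    {U : Ω → ℝ} (hU : Measurable U) {C : NNReal}
    (h : HasSubgaussianMGF U C P) {a : ℝ} (ha : 0 < a) (haC : 4 * a * C ≤ 1) : ExpSq P a U := by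
  refine integrable_of_lintegral_ofReal_le (by fun_prop) (fun _ => (Real.exp_pos _).le)
    zero_le_two ?_
  have h1 : ∀ ω, ENNReal.ofReal (Real.exp (a * U ω ^ 2)) =
      ∫⁻ g, ENNReal.ofReal (Real.exp (√(2 * a) * g * U ω)) ∂(gaussianReal 0 1) := by
    intro ω
    have hi := integrable_exp_mul_gaussianReal (μ := 0) (v := 1) (√(2 * a) * U ω)
    have hm := congrFun (mgf_fun_id_gaussianReal (μ := 0) (v := 1)) (√(2 * a) * U ω)
    have : (fun g : ℝ => Real.exp (√(2 * a) * g * U ω)) =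
        fun g => Real.exp (√(2 * a) * U ω * g) := by ext g; ring_nf
    simp_rw [congrFun this]
    rw [← ofReal_integral_eq_lintegral_ofReal hi (Eventually.of_forall fun _ => by positivity)]
    rw [mgf] at hm
    rw [hm, mul_pow, Real.sq_sqrt (by positivity)]
    congr 2
    push_cast; ring
  simp_rw [h1]
  rw [lintegral_lintegral_swap (by fun_prop)]
  refine le_trans (lintegral_mono fun g => ?_)
    (lintegral_exp_sq_gaussian.trans_eq (by simp))
  rw [← ofReal_integral_eq_lintegral_ofReal (h.integrable_exp_mul _)
    (Eventually.of_forall fun _ => by positivity)]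
  refine ENNReal.ofReal_le_ofReal ((h.mgf_le _).trans ?_)
  rw [Real.exp_le_exp, mul_pow, Real.sq_sqrt (by positivity)]
  nlinarith [sq_nonneg g]

/-- `E exp(a |Q|) ≤ 2`, with integrability. -/
def ExpAbs (P : Measure Ω) (a : ℝ) (Q : Ω → ℝ) : Prop :=
  Integrable (fun ω => Real.exp (a * |Q ω|)) P ∧ ∫ ω, Real.exp (a * |Q ω|) ∂P ≤ 2

theorem ExpSq.mul {U V : Ω → ℝ} (hUm : Measurable U) (hVm : Measurable V) {a : ℝ} (ha : 0 ≤ a)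
    (hU : ExpSq P a U) (hV : ExpSq P a V) : ExpAbs P a (fun ω => U ω * V ω) := by
  have hle : ∀ ω, Real.exp (a * |U ω * V ω|) ≤
      (Real.exp (a * U ω ^ 2) + Real.exp (a * V ω ^ 2)) / 2 := by
    intro ω
    have h1 : a * |U ω * V ω| ≤ a * U ω ^ 2 / 2 + a * V ω ^ 2 / 2 := by
      have : |U ω * V ω| ≤ U ω ^ 2 / 2 + V ω ^ 2 / 2 := by
        rw [abs_mul, ← sq_abs (U ω), ← sq_abs (V ω)]
        nlinarith [sq_nonneg (|U ω| - |V ω|)]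
      nlinarith
    have h2 : Real.exp (a * U ω ^ 2) = Real.exp (a * U ω ^ 2 / 2) ^ 2 := by
      rw [← Real.exp_nat_mul]; push_cast; ring_nf
    have h3 : Real.exp (a * V ω ^ 2) = Real.exp (a * V ω ^ 2 / 2) ^ 2 := by
      rw [← Real.exp_nat_mul]; push_cast; ring_nf
    refine (Real.exp_le_exp.2 h1).trans ?_
    rw [h2, h3, Real.exp_add]
    nlinarith [sq_nonneg (Real.exp (a * U ω ^ 2 / 2) - Real.exp (a * V ω ^ 2 / 2))]
  have hI : Integrable
      (fun ω => (Real.exp (a * U ω ^ 2) + Real.exp (a * V ω ^ 2)) / 2) P :=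
    (hU.1.add hV.1).div_const 2
  have hi : Integrable (fun ω => Real.exp (a * |U ω * V ω|)) P := by
    refine hI.mono' (by fun_prop) (Eventually.of_forall fun ω => ?_)
    rw [Real.norm_of_nonneg (Real.exp_pos _).le]; exact hle ω
  refine ⟨hi, (integral_mono hi hI hle).trans ?_⟩
  rw [integral_div, integral_add hU.1 hV.1]
  linarith [hU.2, hV.2]

/-- Bernstein's argument: in `exp z ≤ 1 + z + z² exp |z|` the linear term has mean zero, and `s² ≤ 8
exp(s/2)` with `s = a |Q|` puts the quadratic term under `8 (t/a)² exp(a |Q|)`. The dominating `Q`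
allows `Z` to carry a sign and an indicator. -/
theorem mgf_le_of_mean_zero [IsProbabilityMeasure P] {Z Q : Ω → ℝ} (hZ : Measurable Z) {a : ℝ}
    (ha : 0 < a) (hQa : ExpAbs P a Q) (hZQ : ∀ ω, |Z ω| ≤ |Q ω|) (h0 : ∫ ω, Z ω ∂P = 0)
    {t : ℝ} (ht : |t| ≤ a / 2) :
    Integrable (fun ω => Real.exp (t * Z ω)) P ∧ mgf Z P t ≤ Real.exp (16 * (t / a) ^ 2) := by
  have hle : ∀ ω, Real.exp (t * Z ω) ≤
      1 + t * Z ω + 8 * (t / a) ^ 2 * Real.exp (a * |Q ω|) := by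
    intro ω
    have h1 := Complex.norm_exp_sub_sum_le_norm_mul_exp ((t * Z ω : ℝ) : ℂ) 2
    have h2 : Real.exp (t * Z ω) - (1 + t * Z ω) ≤ |t * Z ω| ^ 2 * Real.exp |t * Z ω| := by
      rw [← Complex.ofReal_exp] at h1
      simp only [Finset.sum_range_succ, Finset.sum_range_zero, pow_zero, Nat.factorial] at h1
      refine le_trans (le_abs_self _) ?_
      rw [← Real.norm_eq_abs, ← Real.norm_eq_abs, ← Complex.norm_real, ← Complex.norm_real]
      refine le_trans (le_of_eq ?_) h1
      congr 1; push_cast; ring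
    set s := a * |Q ω| with hs
    have hs0 : 0 ≤ s := by positivity
    have h3 : |t * Z ω| ≤ |t| * |Q ω| := by
      rw [abs_mul]; exact mul_le_mul_of_nonneg_left (hZQ ω) (abs_nonneg _)
    have h4 : |t| * |Q ω| ≤ s / 2 := by
      rw [hs]; nlinarith [abs_nonneg (Q ω)]
    have h5 : (|t| * |Q ω|) ^ 2 = (t / a) ^ 2 * s ^ 2 := by
      rw [hs, mul_pow, sq_abs]; field_simp
    have h6 : s ^ 2 ≤ 8 * Real.exp (s / 2) := by
      have := Real.quadratic_le_exp_of_nonneg (x := s / 2) (by positivity)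
      nlinarith
    have h7 : Real.exp s = Real.exp (s / 2) * Real.exp (s / 2) := by
      rw [← Real.exp_add]; ring_nf
    have h8 : |t * Z ω| ^ 2 * Real.exp |t * Z ω| ≤
        ((t / a) ^ 2 * (8 * Real.exp (s / 2))) * Real.exp (s / 2) := by
      refine mul_le_mul ?_ (Real.exp_le_exp.2 (h3.trans h4)) (Real.exp_pos _).le (by positivity)
      calc |t * Z ω| ^ 2 ≤ (|t| * |Q ω|) ^ 2 := by gcongr
        _ ≤ _ := by rw [h5]; gcongr
    rw [h7]
    linarith
  have hZi : Integrable Z P := by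
    refine (hQa.1.const_mul (1 / a)).mono' hZ.aestronglyMeasurable
      (Eventually.of_forall fun ω => ?_)
    have := Real.add_one_le_exp (a * |Q ω|)
    rw [Real.norm_eq_abs, one_div, inv_mul_eq_div, le_div_iff₀ ha]
    nlinarith [hZQ ω]
  have hI : Integrable
      (fun ω => 1 + t * Z ω + 8 * (t / a) ^ 2 * Real.exp (a * |Q ω|)) P :=
    ((integrable_const 1).add (hZi.const_mul t)).add (hQa.1.const_mul _)
  have hi : Integrable (fun ω => Real.exp (t * Z ω)) P := by
    refine hI.mono' (by fun_prop) (Eventually.of_forall fun ω => ?_)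
    rw [Real.norm_of_nonneg (Real.exp_pos _).le]; exact hle ω
  refine ⟨hi, (integral_mono hi hI hle).trans ?_⟩
  have hI' : Integrable (fun ω => 1 + t * Z ω) P := (integrable_const 1).add (hZi.const_mul t)
  rw [integral_add hI' (hQa.1.const_mul _),
    integral_add (integrable_const 1) (hZi.const_mul t), integral_const_mul, integral_const_mul, h0]
  simp only [integral_const, probReal_univ, smul_eq_mul, mul_one, mul_zero, add_zero]
  have := Real.add_one_le_exp (16 * (t / a) ^ 2)
  nlinarith [hQa.2, sq_nonneg (t / a)]

section Indicator

variable {W Q : Ω → ℝ} {B : Set ℝ}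

theorem integral_indicator_mul (hW : Measurable W) (hQ : Measurable Q) (hB : MeasurableSet B)
    (hind : IndepFun Q W P) {g : ℝ → ℝ} (hg : Measurable g) :
    ∫ ω, B.indicator 1 (W ω) * g (Q ω) ∂P = P.real (W ⁻¹' B) * ∫ ω, g (Q ω) ∂P := by
  have h := hind.symm.integral_comp_mul_comp (f := B.indicator (1 : ℝ → ℝ)) (g := g)
    hW.aemeasurable hQ.aemeasurable
    (measurable_one.indicator hB).aestronglyMeasurable hg.aestronglyMeasurable
  have h2 : ∫ ω, B.indicator (1 : ℝ → ℝ) (W ω) ∂P = P.real (W ⁻¹' B) := by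
    rw [← integral_indicator_one (hW hB)]; rfl
  rw [← h2]; exact h

theorem measurable_indicator_comp (hW : Measurable W) (hB : MeasurableSet B) :
    Measurable fun ω => B.indicator (1 : ℝ → ℝ) (W ω) :=
  (measurable_one.indicator hB).comp hW

/-- The exponential differs from `1` only when `W ∈ B`, so by independence its mean is at most `1 +
P(W ∈ B)`. This factor makes the contribution of a short piece proportional to its mass. -/
theorem mgf_indicator_mul_abs_le [IsProbabilityMeasure P]
    (hW : Measurable W) (hQ : Measurable Q) (hB : MeasurableSet B)
    (hind : IndepFun Q W P) {a : ℝ} (hQa : ExpAbs P a Q) :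
    Integrable (fun ω => Real.exp (a * (B.indicator 1 (W ω) * |Q ω|))) P ∧
      mgf (fun ω => B.indicator 1 (W ω) * |Q ω|) P a ≤ Real.exp (P.real (W ⁻¹' B)) := by
  have hm := measurable_indicator_comp hW hB
  have heq : ∀ ω, Real.exp (a * (B.indicator 1 (W ω) * |Q ω|)) =
      1 + B.indicator 1 (W ω) * (Real.exp (a * |Q ω|) - 1) := by
    intro ω
    by_cases h : W ω ∈ B <;> simp [h]
  have hsub : Integrable (fun ω => Real.exp (a * |Q ω|) - 1) P := hQa.1.sub (integrable_const 1)
  have hi : Integrable (fun ω => B.indicator 1 (W ω) * (Real.exp (a * |Q ω|) - 1)) P := by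
    refine hsub.norm.mono' (hm.aestronglyMeasurable.mul hsub.aestronglyMeasurable)
      (Eventually.of_forall fun ω => ?_)
    by_cases h : W ω ∈ B <;> simp [h]
  rw [mgf]
  simp_rw [heq]
  refine ⟨(integrable_const 1).add hi, ?_⟩
  rw [integral_add (integrable_const 1) hi,
    integral_indicator_mul hW hQ hB hind (g := fun q => Real.exp (a * |q|) - 1) (by fun_prop),
    integral_sub hQa.1 (integrable_const 1)]
  simp only [integral_const, probReal_univ, smul_eq_mul, mul_one]
  have h1 := Real.add_one_le_exp (P.real (W ⁻¹' B))
  have h2 : (0 : ℝ) ≤ P.real (W ⁻¹' B) := measureReal_nonneg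
  nlinarith [hQa.2]

/-- The right side times `1 + z + z²/2 ≤ exp z` equals `1 + z⁴/4 ≥ 1`. -/
theorem exp_neg_le_quadratic {z : ℝ} (hz : 0 ≤ z) : Real.exp (-z) ≤ 1 - z + z ^ 2 / 2 := by
  have h := Real.quadratic_le_exp_of_nonneg hz
  have h1 : Real.exp (-z) * Real.exp z = 1 := by rw [← Real.exp_add]; simp
  have h2 := Real.exp_pos (-z)
  have h3 : 0 ≤ 1 - z + z ^ 2 / 2 := by nlinarith [sq_nonneg (z - 1)]
  by_contra! hc
  have h4 : (1 - z + z ^ 2 / 2) * (1 + z + z ^ 2 / 2) < 1 := by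
    calc _ < Real.exp (-z) * Real.exp z := mul_lt_mul hc h (by positivity) h2.le
      _ = 1 := h1
  nlinarith [sq_nonneg (z ^ 2)]

theorem integrable_pow_four {U : Ω → ℝ} (hU : Measurable U) {a : ℝ} (ha : 0 < a)
    (h : ExpSq P a U) : Integrable (fun ω => (U ω ^ 2) ^ 2) P ∧
      ∫ ω, (U ω ^ 2) ^ 2 ∂P ≤ 4 / a ^ 2 := by
  have hle : ∀ ω, (U ω ^ 2) ^ 2 ≤ 2 / a ^ 2 * Real.exp (a * U ω ^ 2) := by
    intro ω
    have := Real.quadratic_le_exp_of_nonneg (x := a * U ω ^ 2) (by positivity)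
    have h0 : 0 ≤ a * U ω ^ 2 := by positivity
    rw [div_mul_eq_mul_div, le_div_iff₀ (by positivity)]
    nlinarith
  have hI := h.1.const_mul (2 / a ^ 2)
  have hi : Integrable (fun ω => (U ω ^ 2) ^ 2) P := by
    refine hI.mono' (by fun_prop) (Eventually.of_forall fun ω => ?_)
    rw [Real.norm_of_nonneg (by positivity)]; exact hle ω
  refine ⟨hi, (integral_mono hi hI hle).trans ?_⟩
  rw [integral_const_mul]
  have : 2 / a ^ 2 * ∫ ω, Real.exp (a * U ω ^ 2) ∂P ≤ 2 / a ^ 2 * 2 := by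
    gcongr; exact h.2
  refine this.trans (le_of_eq (by ring))

/-- For the lower tail of a nonnegative variable, `exp(-z) ≤ 1 - z + z²/2` needs only a fourth
moment of `U`, and holds for every `t ≥ 0`. -/
theorem mgf_neg_indicator_mul_sq_le [IsProbabilityMeasure P]
    {U : Ω → ℝ} (hW : Measurable W) (hU : Measurable U)
    (hB : MeasurableSet B) (hind : IndepFun U W P) {a κ t : ℝ} (ha : 0 < a) (ht : 0 ≤ t)
    (hUa : ExpSq P a U) (hκ : κ ≤ ∫ ω, U ω ^ 2 ∂P) :
    Integrable (fun ω => Real.exp (t * -(B.indicator 1 (W ω) * U ω ^ 2))) P ∧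
      mgf (fun ω => -(B.indicator 1 (W ω) * U ω ^ 2)) P t ≤
        Real.exp (P.real (W ⁻¹' B) * (-(t * κ) + t ^ 2 * (2 / a ^ 2))) := by
  have hm := measurable_indicator_comp hW hB
  obtain ⟨h4, h4le⟩ := integrable_pow_four hU ha hUa
  have h2 : Integrable (fun ω => U ω ^ 2) P := by
    refine (h4.add (integrable_const 1)).mono' (by fun_prop) (Eventually.of_forall fun ω => ?_)
    rw [Real.norm_of_nonneg (by positivity)]
    simp only [Pi.add_apply]
    nlinarith [sq_nonneg (U ω ^ 2 - 1)]
  have hle : ∀ ω, Real.exp (t * -(B.indicator 1 (W ω) * U ω ^ 2)) ≤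
      1 + (B.indicator 1 (W ω) * (-t * U ω ^ 2 + t ^ 2 / 2 * (U ω ^ 2) ^ 2)) := by
    intro ω
    by_cases h : W ω ∈ B
    · have := exp_neg_le_quadratic (z := t * U ω ^ 2) (by positivity)
      simp only [h, Set.indicator_of_mem, Pi.one_apply, one_mul]
      rw [mul_neg]
      refine this.trans (le_of_eq (by ring))
    · simp [h]
  have hs : Integrable (fun ω => -t * U ω ^ 2 + t ^ 2 / 2 * (U ω ^ 2) ^ 2) P :=
    (h2.const_mul _).add (h4.const_mul _)
  have hi' : Integrable
      (fun ω => B.indicator 1 (W ω) * (-t * U ω ^ 2 + t ^ 2 / 2 * (U ω ^ 2) ^ 2)) P := by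
    refine hs.norm.mono' (hm.aestronglyMeasurable.mul hs.aestronglyMeasurable)
      (Eventually.of_forall fun ω => ?_)
    by_cases h : W ω ∈ B <;> simp [h]
  have hI := (integrable_const (1 : ℝ)).add hi'
  have hi : Integrable (fun ω => Real.exp (t * -(B.indicator 1 (W ω) * U ω ^ 2))) P := by
    refine hI.mono' (by fun_prop) (Eventually.of_forall fun ω => ?_)
    rw [Real.norm_of_nonneg (Real.exp_pos _).le]; exact hle ω
  refine ⟨hi, (integral_mono hi hI hle).trans ?_⟩
  simp only [Pi.add_apply]
  rw [integral_add (integrable_const 1) hi',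
    integral_indicator_mul hW hU hB hind (g := fun q => -t * q ^ 2 + t ^ 2 / 2 * (q ^ 2) ^ 2)
      (by fun_prop),
    integral_add (h2.const_mul _) (h4.const_mul _), integral_const_mul, integral_const_mul]
  simp only [integral_const, probReal_univ, smul_eq_mul, mul_one]
  refine le_trans ?_ (Real.add_one_le_exp _)
  rw [add_comm]
  have h5 : (0 : ℝ) ≤ P.real (W ⁻¹' B) := measureReal_nonneg
  have h6 : t ^ 2 / 2 * ∫ ω, (U ω ^ 2) ^ 2 ∂P ≤ t ^ 2 * (2 / a ^ 2) :=
    calc t ^ 2 / 2 * ∫ ω, (U ω ^ 2) ^ 2 ∂P ≤ t ^ 2 / 2 * (4 / a ^ 2) := by gcongr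
      _ = _ := by ring
  have h7 : t * κ ≤ t * ∫ ω, U ω ^ 2 ∂P := by gcongr
  have h8 : -t * ∫ ω, U ω ^ 2 ∂P + t ^ 2 / 2 * ∫ ω, (U ω ^ 2) ^ 2 ∂P ≤
      -(t * κ) + t ^ 2 * (2 / a ^ 2) := by linarith
  exact add_le_add_left (mul_le_mul_of_nonneg_left h8 h5) 1

end Indicator

theorem measure_sum_ge_le_exp [IsProbabilityMeasure P]
    {n : ℕ} {Z : Fin n → Ω → ℝ} (hZ : ∀ i, Measurable (Z i))
    (hind : iIndepFun Z P) {t b : ℝ} (ht : 0 ≤ t)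
    (h : ∀ i, Integrable (fun ω => Real.exp (t * Z i ω)) P ∧ mgf (Z i) P t ≤ Real.exp b) (r : ℝ) :
    P {ω | r ≤ ∑ i, Z i ω} ≤ ENNReal.ofReal (Real.exp (n * b - t * r)) := by
  have hi := hind.integrable_exp_mul_sum (t := t) hZ (s := Finset.univ) fun i _ => (h i).1
  have h1 := measure_ge_le_exp_mul_mgf (μ := P) r ht hi
  rw [hind.mgf_sum hZ] at h1
  have h2 : ∏ i, mgf (Z i) P t ≤ Real.exp (n * b) := by
    calc ∏ i, mgf (Z i) P t ≤ ∏ _i : Fin n, Real.exp b :=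
          Finset.prod_le_prod (fun i _ => mgf_nonneg) fun i _ => (h i).2
      _ = Real.exp (n * b) := by simp [← Real.exp_nat_mul]
  have h3 : P.real {ω | r ≤ ∑ i, Z i ω} ≤ Real.exp (n * b - t * r) := by
    simp only [Finset.sum_apply] at h1
    refine h1.trans ((mul_le_mul_of_nonneg_left h2 (Real.exp_pos _).le).trans (le_of_eq ?_))
    rw [← Real.exp_add]; ring_nf
  rw [← ofReal_measureReal]
  exact ENNReal.ofReal_le_ofReal h3

end Moments

/-! ### Maurey's method and the deterministic Lasso inequality. -/

section Deterministic

/-- Greedy form of Maurey's empirical method: if `v` is the mean of the vectors `z j`, some sum of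
`k` of them is at most as large, for the quadratic form of `b`, as it is on average. -/
theorem exists_sum_le_average {E J : Type*} [AddCommGroup E] [Module ℝ E] [Fintype J]
    (b : E →ₗ[ℝ] E →ₗ[ℝ] ℝ) (q : J → ℝ) (hq : ∀ j, 0 ≤ q j) (hq1 : ∑ j, q j = 1)
    (z : J → E) {v : E} (hv : ∑ j, q j • z j = v) (k : ℕ) (w : E) :
    ∃ f : Fin k → J, b (w + ∑ i, z (f i)) (w + ∑ i, z (f i)) ≤
      b (w + (k : ℝ) • v) (w + (k : ℝ) • v) + k * (∑ j, q j * b (z j) (z j) - b v v) := by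
  induction k generalizing w with
  | zero => exact ⟨Fin.elim0, by simp⟩
  | succ k ih =>
    set V := ∑ j, q j * b (z j) (z j) - b v v with hV
    set u := w + (k : ℝ) • v with hu
    -- The summands not yet chosen are replaced by their mean `v`. Averaging over the current one,
    -- the cross terms see only `v`, and the variance `V` is added.
    have hmean : ∑ j, q j * b (u + z j) (u + z j) = b (u + v) (u + v) + V := by
      have h1 : ∑ j, q j * b u (z j) = b u v := by
        rw [← hv, map_sum]; simp
      have h2 : ∑ j, q j * b (z j) u = b v u := by
        rw [← hv, map_sum, LinearMap.sum_apply]; simp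
      simp only [map_add, LinearMap.add_apply, mul_add, Finset.sum_add_distrib, h1, h2,
        ← Finset.sum_mul, hq1, hV]
      ring
    obtain ⟨j, hj⟩ : ∃ j, b (u + z j) (u + z j) ≤ b (u + v) (u + v) + V := by
      by_contra! hc
      have h3 : ∑ j, q j * (b (u + v) (u + v) + V) < ∑ j, q j * b (u + z j) (u + z j) := by
        obtain ⟨j, -, hj⟩ : ∃ j ∈ Finset.univ, q j ≠ 0 := by
          by_contra! h0
          rw [Finset.sum_eq_zero h0] at hq1
          exact zero_ne_one hq1
        exact Finset.sum_lt_sum (fun i _ => mul_le_mul_of_nonneg_left (hc i).le (hq i))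
          ⟨j, Finset.mem_univ _, mul_lt_mul_of_pos_left (hc j) ((hq j).lt_of_ne' hj)⟩
      rw [← Finset.sum_mul, hq1, hmean] at h3
      linarith
    obtain ⟨f, hf⟩ := ih (w + z j)
    refine ⟨Fin.cons j f, ?_⟩
    rw [Fin.sum_univ_succ]
    simp only [Fin.cons_zero, Fin.cons_succ]
    rw [← add_assoc]
    refine hf.trans ?_
    have h4 : w + z j + (k : ℝ) • v = u + z j := by rw [hu]; abel
    have h5 : w + ((k + 1 : ℕ) : ℝ) • v = u + v := by
      rw [hu]; push_cast; rw [add_smul, one_smul]; abel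
    rw [h4, h5]
    push_cast
    linarith

variable {n p : ℕ}

/-- The quadratic form `∑ c_i (x_iᵀ u)²`. -/
def gram (c : Fin n → ℝ) (x : Fin n → Fin p → ℝ) (u : Fin p → ℝ) : ℝ :=
  ∑ i, c i * (x i ⬝ᵥ u) ^ 2

/-- The vector `∑ ± e_l` with the signs and the indices `l` given by `f`. -/
def signedSum {k : ℕ} (f : Fin k → Fin p × SignType) : Fin p → ℝ :=
  ∑ i, Pi.single (f i).1 (((f i).2 : SignType) : ℝ)

/-- Maurey's method for the form `gram - θ ‖·‖²`, which is nonnegative on signed sums: `v` is the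
mean of the vectors `±‖v‖₁ e_l` taken with weights `|v l| / ‖v‖₁`. The result is `0 ≤ (k - 1) b(v,
v) + ‖v‖₁² D`. -/
theorem gram_lower_bound (c : Fin n → ℝ) (x : Fin n → Fin p → ℝ) {θ D : ℝ} (hθ : 0 ≤ θ) {k : ℕ}
    (hk : 2 ≤ k)
    (hsparse : ∀ f : Fin k → Fin p × SignType,
      θ * (signedSum f ⬝ᵥ signedSum f) ≤ gram c x (signedSum f))
    (hdiag : ∀ l, ∑ i, c i * x i l ^ 2 ≤ D) (v : Fin p → ℝ) :
    θ * (v ⬝ᵥ v) - (∑ l, |v l|) ^ 2 * D / (k - 1) ≤ gram c x v := by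
  have hk' : (1 : ℝ) < k := by exact_mod_cast hk
  set L := ∑ l, |v l| with hL
  have hL0 : 0 ≤ L := Finset.sum_nonneg fun _ _ => abs_nonneg _
  rcases hL0.eq_or_lt with h0 | hLpos
  · have hv : v = 0 := by
      ext l
      have := (Finset.sum_eq_zero_iff_of_nonneg (fun _ _ => abs_nonneg _)).1 h0.symm l
        (Finset.mem_univ l)
      simpa using this
    rw [← h0]
    simp [hv, gram]
  let b : (Fin p → ℝ) →ₗ[ℝ] (Fin p → ℝ) →ₗ[ℝ] ℝ := LinearMap.mk₂ ℝ
    (fun u u' => ∑ i, c i * ((x i ⬝ᵥ u) * (x i ⬝ᵥ u')) - θ * (u ⬝ᵥ u'))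
    (fun u₁ u₂ u' => by
      simp only [dotProduct_add, add_dotProduct, add_mul, mul_add, Finset.sum_add_distrib]; ring)
    (fun r u u' => by
      simp only [dotProduct_smul, smul_dotProduct, smul_eq_mul, mul_sub, Finset.mul_sum]
      congr 1
      · exact Finset.sum_congr rfl fun _ _ => by ring
      · ring)
    (fun u u₁ u₂ => by
      simp only [dotProduct_add, mul_add, Finset.sum_add_distrib]; ring)
    (fun r u u' => by
      simp only [dotProduct_smul, smul_eq_mul, mul_sub, Finset.mul_sum]
      congr 1
      · exact Finset.sum_congr rfl fun _ _ => by ring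
      · ring)
  have hb : ∀ u, b u u = gram c x u - θ * (u ⬝ᵥ u) := fun u => by
    simp only [b, LinearMap.mk₂_apply, gram, sq]
  have hbs : ∀ (r : ℝ) u, b (r • u) (r • u) = r * r * b u u := fun r u => by
    rw [hb, hb]
    simp only [gram, dotProduct_smul, smul_dotProduct, smul_eq_mul, mul_sub, Finset.mul_sum]
    congr 1
    · exact Finset.sum_congr rfl fun _ _ => by ring
    · ring
  let sg : Fin p → ℝ := fun l => ((SignType.sign (v l) : SignType) : ℝ)
  let z : Fin p → Fin p → ℝ := fun l => L • Pi.single l (sg l)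
  have hz : ∀ l, (|v l| / L) • z l = Pi.single l (v l) := by
    intro l
    simp only [z, sg]
    rw [smul_smul, div_mul_cancel₀ _ hLpos.ne', ← Pi.single_smul, smul_eq_mul, mul_comm,
      sign_mul_abs]
  obtain ⟨f, hf⟩ := exists_sum_le_average b (fun l => |v l| / L) (fun l => by positivity)
    (by rw [← Finset.sum_div, ← hL, div_self hLpos.ne']) z (v := v)
    (by simp_rw [hz]; exact Finset.univ_sum_single v) k 0
  have hsum : ∑ i, z (f i) = L • signedSum fun i => (f i, SignType.sign (v (f i))) := by
    simp only [z, sg, signedSum, Finset.smul_sum]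
  have hpos : 0 ≤ b (∑ i, z (f i)) (∑ i, z (f i)) := by
    rw [hsum, hbs, hb]
    have := hsparse fun i => (f i, SignType.sign (v (f i)))
    have h3 : 0 ≤ gram c x (signedSum fun i => (f i, SignType.sign (v (f i)))) -
      θ * ((signedSum fun i => (f i, SignType.sign (v (f i)))) ⬝ᵥ
        (signedSum fun i => (f i, SignType.sign (v (f i))))) := by linarith
    positivity
  have hzz : ∀ l, |v l| / L * b (z l) (z l) ≤ |v l| * (L * D) := by
    intro l
    have h1 : b (z l) (z l) = L * L * (sg l ^ 2 * (∑ i, c i * x i l ^ 2 - θ)) := by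
      simp only [z]
      rw [hbs, hb]
      simp only [gram, dotProduct_single, Pi.single_eq_same, Finset.mul_sum,
        mul_sub]
      congr 1
      · exact Finset.sum_congr rfl fun _ _ => by ring
      · ring
    -- Where `v l = 0` the sign is `0`, but so is the weight.
    rcases eq_or_ne (v l) 0 with hvl | hvl
    · simp [hvl]
    have h2 : sg l ^ 2 = 1 := by
      simp only [sg]
      rcases hvl.lt_or_gt with h | h
      · rw [sign_neg h]; simp
      · rw [sign_pos h]; simp
    rw [h1, h2, one_mul, div_mul_eq_mul_div, div_le_iff₀ hLpos]
    have h3 : ∑ i, c i * x i l ^ 2 - θ ≤ D := by linarith [hdiag l]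
    calc _ = (|v l| * (L * L)) * (∑ i, c i * x i l ^ 2 - θ) := by ring
      _ ≤ (|v l| * (L * L)) * D := by gcongr
      _ = _ := by ring
  have hsumz : ∑ l, |v l| / L * b (z l) (z l) ≤ L ^ 2 * D := by
    refine (Finset.sum_le_sum fun l _ => hzz l).trans (le_of_eq ?_)
    rw [← Finset.sum_mul, ← hL]; ring
  simp only [zero_add] at hf
  rw [hbs] at hf
  have h4 : 0 ≤ (k : ℝ) * ((k - 1) * b v v + L ^ 2 * D) := by
    have : (k : ℝ) * (∑ l, |v l| / L * b (z l) (z l) - b v v) ≤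
      k * (L ^ 2 * D - b v v) := by gcongr
    nlinarith
  have h5 : 0 ≤ (k - 1) * b v v + L ^ 2 * D := nonneg_of_mul_nonneg_right h4 (by linarith)
  rw [hb] at h5
  have h6 : (L ^ 2 * D / (k - 1)) * (k - 1) = L ^ 2 * D := div_mul_cancel₀ _ (by linarith)
  have h7 : 0 ≤ ((k : ℝ) - 1) * (gram c x v - θ * (v ⬝ᵥ v) + L ^ 2 * D / (k - 1)) := by
    nlinarith
  have := nonneg_of_mul_nonneg_right h7 (by linarith)
  linarith

theorem lqNorm_one (v : Fin p → ℝ) : lqNorm 1 v = ∑ l, |v l| := by simp [lqNorm]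

theorem lqNorm_two (v : Fin p → ℝ) : lqNorm 2 v = √(v ⬝ᵥ v) := by
  rw [lqNorm, Real.sqrt_eq_rpow]
  congr 1
  exact Finset.sum_congr rfl fun l _ => by
    rw [← sq, ← sq_abs (v l)]; exact_mod_cast Real.rpow_natCast _ 2

theorem dotProduct_self_nonneg' (v : Fin p → ℝ) : 0 ≤ v ⬝ᵥ v :=
  Finset.sum_nonneg fun _ _ => mul_self_nonneg _

theorem lqNorm_two_sq (v : Fin p → ℝ) : lqNorm 2 v ^ 2 = v ⬝ᵥ v := by
  rw [lqNorm_two, Real.sq_sqrt (dotProduct_self_nonneg' v)]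

theorem lqNorm_nonneg (q : ℝ) (v : Fin p → ℝ) : 0 ≤ lqNorm q v :=
  Real.rpow_nonneg (Finset.sum_nonneg fun _ _ => Real.rpow_nonneg (abs_nonneg _) _) _

theorem sum_abs_le_sqrt_mul (S : Finset (Fin p)) {s : ℝ} (hS : (S.card : ℝ) ≤ s)
    (v : Fin p → ℝ) : ∑ l ∈ S, |v l| ≤ √s * √(v ⬝ᵥ v) := by
  rw [← Real.sqrt_mul ((Nat.cast_nonneg _).trans hS)]
  refine Real.le_sqrt_of_sq_le (sq_sum_le_card_mul_sum_sq.trans ?_)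
  have h1 : ∑ l ∈ S, |v l| ^ 2 ≤ v ⬝ᵥ v := by
    refine (Finset.sum_le_univ_sum_of_nonneg fun _ => by positivity).trans (le_of_eq ?_)
    exact Finset.sum_congr rfl fun l _ => by rw [sq_abs, sq]
  exact mul_le_mul hS h1 (Finset.sum_nonneg fun _ _ => by positivity)
    ((Nat.cast_nonneg _).trans hS)

theorem segInd_nonneg (a b : EReal) (t : ℝ) : 0 ≤ segInd a b t := by
  unfold segInd; split_ifs <;> norm_num

theorem lasso_error_bound {y : Fin n → ℝ} {x : Fin n → Fin p → ℝ} {w : Fin n → ℝ} {a b : EReal}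
    {lam : ℝ} {γ : Fin p → ℝ} (hγ : IsLasso y x w a b lam γ) (hlam : 0 < lam) {β : Fin p → ℝ}
    (S : Finset (Fin p)) (hβ : ∀ l, l ∉ S → β l = 0) {s θ : ℝ} (hs : (S.card : ℝ) ≤ s)
    (hθ : 0 < θ)
    (hscore : ∀ l, |∑ i, 1 / (n : ℝ) * segInd a b (w i) * ((y i - x i ⬝ᵥ β) * x i l)| ≤ lam / 4)
    (hRE : ∀ v : Fin p → ℝ, ∑ l, |v l| ≤ 4 * ∑ l ∈ S, |v l| →
      θ * (v ⬝ᵥ v) ≤ gram (fun i => 1 / (n : ℝ) * segInd a b (w i)) x v) :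
    lqNorm 1 (γ - β) ≤ 6 * s * lam / θ ∧ lqNorm 2 (γ - β) ≤ 3 / 2 * √s * lam / θ := by
  set v := γ - β with hv
  set c : Fin n → ℝ := fun i => 1 / (n : ℝ) * segInd a b (w i) with hc
  have hγv : γ = β + v := by rw [hv]; abel
  have hs0 : 0 ≤ s := (Nat.cast_nonneg _).trans hs
  have hloss : ∀ u, 1 / (n : ℝ) * segLoss y x w u a b = ∑ i, c i * (y i - x i ⬝ᵥ u) ^ 2 := by
    intro u
    rw [segLoss, Finset.mul_sum]
    exact Finset.sum_congr rfl fun i _ => by rw [hc]; ring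
  have hbasic := hγ β
  rw [hloss, hloss, lqNorm_one, lqNorm_one] at hbasic
  have hexp : ∑ i, c i * (y i - x i ⬝ᵥ γ) ^ 2 = ∑ i, c i * (y i - x i ⬝ᵥ β) ^ 2 -
      2 * ∑ l, v l * ∑ i, c i * ((y i - x i ⬝ᵥ β) * x i l) + gram c x v := by
    have h1 : ∑ l, v l * ∑ i, c i * ((y i - x i ⬝ᵥ β) * x i l) =
        ∑ i, c i * ((y i - x i ⬝ᵥ β) * (x i ⬝ᵥ v)) := by
      simp only [Finset.mul_sum, dotProduct]
      rw [Finset.sum_comm]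
      refine Finset.sum_congr rfl fun i _ => Finset.sum_congr rfl fun l _ => by ring
    rw [h1, gram, Finset.mul_sum, ← Finset.sum_sub_distrib, ← Finset.sum_add_distrib]
    refine Finset.sum_congr rfl fun i _ => ?_
    rw [hγv, dotProduct_add]; ring
  have hscore' : ∑ l, v l * ∑ i, c i * ((y i - x i ⬝ᵥ β) * x i l) ≤ lam / 4 * ∑ l, |v l| := by
    rw [Finset.mul_sum]
    refine Finset.sum_le_sum fun l _ => (le_abs_self _).trans ?_
    rw [abs_mul, mul_comm]
    exact mul_le_mul_of_nonneg_right (hscore l) (abs_nonneg _)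
  have hl1 : ∑ l, |β l| - ∑ l, |γ l| ≤ 2 * ∑ l ∈ S, |v l| - ∑ l, |v l| := by
    have h1 : ∀ l, |β l| - |γ l| ≤ (if l ∈ S then 2 * |v l| else 0) - |v l| := by
      intro l
      have h2 : γ l = β l + v l := congrFun hγv l
      rw [h2]
      split_ifs with h
      · have := abs_sub_abs_le_abs_sub (β l) (β l + v l)
        rw [sub_add_cancel_left, abs_neg] at this
        linarith
      · rw [hβ l h]; simp
    have h3 := Finset.sum_le_sum fun l (_ : l ∈ Finset.univ) => h1 l
    rw [Finset.sum_sub_distrib, Finset.sum_sub_distrib, ← Finset.sum_filter,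
      Finset.filter_univ_mem, ← Finset.mul_sum] at h3
    exact h3
  have hG0 : 0 ≤ gram c x v := Finset.sum_nonneg fun i _ =>
    mul_nonneg (mul_nonneg (by positivity) (segInd_nonneg _ _ _)) (sq_nonneg _)
  -- Twice the score costs `lam / 2` of the `ℓ₁` norm, half of what the penalty provides. Dropping
  -- the Gram term gives the cone with constant `4`; keeping it gives the factor `3 / 2`.
  have hmain : gram c x v + lam / 2 * ∑ l, |v l| ≤ 2 * lam * ∑ l ∈ S, |v l| := by
    rw [hexp] at hbasic
    nlinarith
  have hcone : ∑ l, |v l| ≤ 4 * ∑ l ∈ S, |v l| := by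
    have : lam * ∑ l, |v l| ≤ lam * (4 * ∑ l ∈ S, |v l|) := by linarith
    exact le_of_mul_le_mul_left this hlam
  have hre := hRE v hcone
  have hS : ∑ l ∈ S, |v l| ≤ ∑ l, |v l| :=
    Finset.sum_le_univ_sum_of_nonneg fun _ => abs_nonneg _
  have hCS := sum_abs_le_sqrt_mul S hs v
  set V := √(v ⬝ᵥ v) with hV
  have hV0 : 0 ≤ V := Real.sqrt_nonneg _
  have hVV : v ⬝ᵥ v = V * V := (Real.mul_self_sqrt (dotProduct_self_nonneg' v)).symm
  have hVle : V ≤ 3 / 2 * √s * lam / θ := by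
    rw [le_div_iff₀ hθ]
    rcases hV0.eq_or_lt with h0 | hpos
    · rw [← h0]; have := Real.sqrt_nonneg s; simp only [zero_mul]; positivity
    · have h1 : V * (V * θ) ≤ V * (3 / 2 * √s * lam) := by
        rw [hVV] at hre
        have h2 : lam * ∑ l ∈ S, |v l| ≤ lam * (√s * V) := by gcongr
        nlinarith
      exact le_of_mul_le_mul_left h1 hpos
  refine ⟨?_, by rw [lqNorm_two]; exact hVle⟩
  rw [lqNorm_one]
  calc ∑ l, |v l| ≤ 4 * (√s * V) := by linarith
    _ ≤ 4 * (√s * (3 / 2 * √s * lam / θ)) := by gcongr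
    _ = 6 * (√s * √s) * lam / θ := by ring
    _ = _ := by rw [Real.mul_self_sqrt hs0]

end Deterministic

/-! ### Tail bounds for the sample. -/

namespace Setup

section Tails

variable {n : ℕ} {M : Setup n} {C : NNReal} {κ φ : ℝ}

theorem ConditionD.measurable_dot (h : M.ConditionD C κ φ) (i : Fin n) (u : Fin M.p → ℝ) :
    Measurable fun ω => M.x i ω ⬝ᵥ u := by
  have := h.measurable_x i
  unfold dotProduct
  fun_prop

theorem ConditionD.measurable_coord (h : M.ConditionD C κ φ) (i : Fin n) (l : Fin M.p) :
    Measurable fun ω => M.x i ω l :=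
  (measurable_pi_apply l).comp (h.measurable_x i)

theorem lqNorm_two_single {p : ℕ} (l : Fin p) : lqNorm 2 (Pi.single l (1 : ℝ)) = 1 := by
  rw [lqNorm_two]; simp

theorem ConditionD.expSq_dot (h : M.ConditionD C κ φ) {a : ℝ} (ha : 0 < a) (haC : 4 * a * C ≤ 1)
    (i : Fin n) {u : Fin M.p → ℝ} (hu : lqNorm 2 u = 1) :
    ExpSq M.P a (fun ω => M.x i ω ⬝ᵥ u) := by
  refine expSq_of_hasSubgaussianMGF (h.measurable_dot i u) ?_ ha haC
  have h1 := h.subgaussian_x u hu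
  rw [← h.law_x i] at h1
  have h2 := HasSubgaussianMGF.of_map (h.measurable_x i).aemeasurable h1
  exact h2

theorem ConditionD.expSq_coord (h : M.ConditionD C κ φ) {a : ℝ} (ha : 0 < a)
    (haC : 4 * a * C ≤ 1) (i : Fin n) (l : Fin M.p) : ExpSq M.P a (fun ω => M.x i ω l) := by
  simpa using h.expSq_dot ha haC i (lqNorm_two_single l)

theorem ConditionD.expSq_ε (h : M.ConditionD C κ φ) {a : ℝ} (ha : 0 < a) (haC : 4 * a * C ≤ 1)
    (i : Fin n) : ExpSq M.P a (M.ε i) := by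
  refine expSq_of_hasSubgaussianMGF (h.measurable_ε i) ?_ ha haC
  have h1 := h.subgaussian_ε
  rw [← h.law_ε i] at h1
  have h2 := HasSubgaussianMGF.of_map (h.measurable_ε i).aemeasurable h1
  exact h2

theorem ConditionD.real_preimage (h : M.ConditionD C κ φ) (i : Fin n) {B : Set ℝ}
    (hB : MeasurableSet B) : M.P.real (M.w i ⁻¹' B) = M.lawW.real B := by
  rw [← h.law_w i, map_measureReal_apply (h.measurable_w i) hB]

theorem ConditionD.le_integral_sq (h : M.ConditionD C κ φ) (i : Fin n) {u : Fin M.p → ℝ}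
    (hu : lqNorm 2 u = 1) : κ ≤ ∫ ω, (M.x i ω ⬝ᵥ u) ^ 2 ∂M.P := by
  have h1 := h.le_eigen u
  rw [hu, one_pow, mul_one] at h1
  refine h1.trans (le_of_eq ?_)
  have h2 : ∫ ω, (M.x i ω ⬝ᵥ u) ^ 2 ∂M.P = ∫ v, (v ⬝ᵥ u) ^ 2 ∂M.lawX := by
    rw [← h.law_x i, integral_map (h.measurable_x i).aemeasurable]
    exact (Measurable.pow_const (by unfold dotProduct; fun_prop) 2).aestronglyMeasurable
  have hL : ∀ l : Fin M.p, MemLp (fun v : Fin M.p → ℝ => v l) 2 M.lawX := by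
    intro l
    have := (h.subgaussian_x _ (lqNorm_two_single l)).memLp 2
    simpa using this
  have hI : ∀ k l : Fin M.p, Integrable (fun v : Fin M.p → ℝ => v k * v l) M.lawX :=
    fun k l => (hL k).integrable_mul (hL l)
  have h3 : ∀ v : Fin M.p → ℝ, (v ⬝ᵥ u) ^ 2 = ∑ k, ∑ l, u k * u l * (v k * v l) := by
    intro v
    rw [sq, dotProduct, Finset.sum_mul_sum]
    exact Finset.sum_congr rfl fun k _ => Finset.sum_congr rfl fun l _ => by ring
  rw [h2]
  simp_rw [h3]
  rw [integral_finsetSum _ fun k _ => integrable_finsetSum _ fun l _ => (hI k l).const_mul _]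
  simp only [dotProduct, Matrix.mulVec, Finset.mul_sum]
  refine Finset.sum_congr rfl fun k _ => ?_
  rw [integral_finsetSum _ fun l _ => (hI k l).const_mul _]
  refine Finset.sum_congr rfl fun l _ => ?_
  rw [integral_const_mul, Sig]; ring

/-- The summands are centred because `x` is centred and independent of the pair `(w, ε)`. The sign
`σ` serves both tails. -/
theorem ConditionD.noise_tail (h : M.ConditionD C κ φ) {a : ℝ} (ha : 0 < a)
    (haC : 4 * a * C ≤ 1) {B : Set ℝ} (hB : MeasurableSet B) (l : Fin M.p) {σ : ℝ} (hσ : |σ| = 1)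
    {θ : ℝ} (hθ : 0 ≤ θ) (hθ' : θ ≤ 1 / 2) (r : ℝ) :
    M.P {ω | r ≤ ∑ i, M.x i ω l * (σ * (B.indicator 1 (M.w i ω) * M.ε i ω))} ≤
      ENNReal.ofReal (Real.exp (n * (16 * θ ^ 2) - θ * a * r)) := by
  have hg : Measurable fun z : ℝ × ℝ => σ * (B.indicator (1 : ℝ → ℝ) z.1 * z.2) :=
    (((measurable_one.indicator hB).comp measurable_fst).mul measurable_snd).const_mul σ
  have hV : ∀ i, Measurable fun ω => σ * (B.indicator (1 : ℝ → ℝ) (M.w i ω) * M.ε i ω) :=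
    fun i => hg.comp ((h.measurable_w i).prodMk (h.measurable_ε i))
  have hZ : ∀ i, Measurable fun ω => M.x i ω l * (σ * (B.indicator 1 (M.w i ω) * M.ε i ω)) :=
    fun i => (h.measurable_coord i l).mul (hV i)
  refine measure_sum_ge_le_exp hZ ?_ (t := θ * a) (by positivity) (fun i => ?_) r
  · exact h.indep_obs.comp
      (fun _ z => z.1 l * (σ * (B.indicator (1 : ℝ → ℝ) z.2.1 * z.2.2)))
      fun _ => ((measurable_pi_apply l).comp measurable_fst).mul (hg.comp measurable_snd)
  · have hQ := (h.expSq_coord ha haC i l).mul (h.measurable_coord i l) (h.measurable_ε i) ha.le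
      (h.expSq_ε ha haC i)
    have h0 : ∫ ω, M.x i ω l * (σ * (B.indicator 1 (M.w i ω) * M.ε i ω)) ∂M.P = 0 := by
      have h1 := (h.indep_x i).integral_comp_mul_comp (f := fun v => v l)
        (g := fun z : ℝ × ℝ => σ * (B.indicator (1 : ℝ → ℝ) z.1 * z.2))
        (h.measurable_x i).aemeasurable ((h.measurable_w i).prodMk (h.measurable_ε i)).aemeasurable
        (measurable_pi_apply l).aestronglyMeasurable hg.aestronglyMeasurable
      have h2 : ∫ ω, M.x i ω l ∂M.P = 0 := by
        rw [← h.mean_x l, ← h.law_x i, integral_map (h.measurable_x i).aemeasurable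
          (measurable_pi_apply l).aestronglyMeasurable]
      refine h1.trans ?_
      have h3 : M.P[(fun v : Fin M.p → ℝ => v l) ∘ M.x i] = 0 := h2
      rw [h3, zero_mul]
    have := mgf_le_of_mean_zero (hZ i) ha hQ (fun ω => ?_) h0 (t := θ * a) (by
      rw [abs_of_nonneg (by positivity)]; nlinarith)
    · rwa [mul_div_cancel_right₀ _ ha.ne'] at this
    · rw [abs_mul, abs_mul, abs_mul, hσ, one_mul, abs_mul]
      refine mul_le_mul_of_nonneg_left ?_ (abs_nonneg _)
      by_cases hw : M.w i ω ∈ B <;> simp [hw]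

theorem ConditionD.product_tail (h : M.ConditionD C κ φ) {a : ℝ} (ha : 0 < a)
    (haC : 4 * a * C ≤ 1) {B : Set ℝ} (hB : MeasurableSet B) (l : Fin M.p) {u : Fin M.p → ℝ}
    (hu : lqNorm 2 u = 1) (r : ℝ) :
    M.P {ω | r ≤ ∑ i, B.indicator 1 (M.w i ω) * |(M.x i ω ⬝ᵥ u) * M.x i ω l|} ≤
      ENNReal.ofReal (Real.exp (n * M.lawW.real B - a * r)) := by
  have hg : Measurable fun v : Fin M.p → ℝ => (v ⬝ᵥ u) * v l := by
    unfold dotProduct; fun_prop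
  have hQm : ∀ i, Measurable fun ω => (M.x i ω ⬝ᵥ u) * M.x i ω l :=
    fun i => hg.comp (h.measurable_x i)
  have hI : Measurable fun t => B.indicator (1 : ℝ → ℝ) t := measurable_one.indicator hB
  refine measure_sum_ge_le_exp (fun i => ?_) ?_ ha.le (fun i => ?_) r
  · exact (hI.comp (h.measurable_w i)).mul (hQm i).abs
  · exact h.indep_obs.comp (fun _ z => B.indicator (1 : ℝ → ℝ) z.2.1 * |(z.1 ⬝ᵥ u) * z.1 l|)
      fun _ => (hI.comp (measurable_fst.comp measurable_snd)).mul (hg.comp measurable_fst).abs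
  · have hQ := (h.expSq_dot ha haC i hu).mul (h.measurable_dot i u) (h.measurable_coord i l) ha.le
      (h.expSq_coord ha haC i l)
    rw [← h.real_preimage i hB]
    exact mgf_indicator_mul_abs_le (h.measurable_w i) (hQm i) hB
      ((h.indep_x i).comp hg measurable_fst) hQ

theorem ConditionD.lower_tail (h : M.ConditionD C κ φ) {a : ℝ} (ha : 0 < a)
    (haC : 4 * a * C ≤ 1) {B : Set ℝ} (hB : MeasurableSet B) {u : Fin M.p → ℝ}
    (hu : lqNorm 2 u = 1) {t : ℝ} (ht : 0 ≤ t) (r : ℝ) :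
    M.P {ω | ∑ i, B.indicator 1 (M.w i ω) * (M.x i ω ⬝ᵥ u) ^ 2 ≤ r} ≤
      ENNReal.ofReal (Real.exp
        (n * (M.lawW.real B * (-(t * κ) + t ^ 2 * (2 / a ^ 2))) + t * r)) := by
  have hg : Measurable fun v : Fin M.p → ℝ => v ⬝ᵥ u := by
    unfold dotProduct; fun_prop
  have hI : Measurable fun t => B.indicator (1 : ℝ → ℝ) t := measurable_one.indicator hB
  have := measure_sum_ge_le_exp (P := M.P)
    (Z := fun i ω => -(B.indicator 1 (M.w i ω) * (M.x i ω ⬝ᵥ u) ^ 2)) (t := t)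
    (b := M.lawW.real B * (-(t * κ) + t ^ 2 * (2 / a ^ 2))) (fun i => ?_) ?_ ht (fun i => ?_) (-r)
  · simpa [Finset.sum_neg_distrib] using this
  · exact ((hI.comp (h.measurable_w i)).mul ((h.measurable_dot i u).pow_const 2)).neg
  · exact h.indep_obs.comp (fun _ z => -(B.indicator (1 : ℝ → ℝ) z.2.1 * (z.1 ⬝ᵥ u) ^ 2))
      fun _ => ((hI.comp (measurable_fst.comp measurable_snd)).mul
        ((hg.comp measurable_fst).pow_const 2)).neg
  · rw [← h.real_preimage i hB]
    exact mgf_neg_indicator_mul_sq_le (h.measurable_w i) (h.measurable_dot i u) hB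
      ((h.indep_x i).comp hg measurable_fst) ha ht (h.expSq_dot ha haC i hu)
      (h.le_integral_sq i hu)

end Tails

end Setup

/-- The segment `(a, b]`. -/
def seg (a b : EReal) : Set ℝ := {t | a < (t : EReal) ∧ (t : EReal) ≤ b}

theorem measurableSet_seg (a b : EReal) : MeasurableSet (seg a b) :=
  (measurableSet_lt measurable_const measurable_coe_real_ereal).inter
    (measurableSet_le measurable_coe_real_ereal measurable_const)

theorem segInd_eq (a b : EReal) (t : ℝ) : segInd a b t = (seg a b).indicator 1 t := by
  by_cases h : t ∈ seg a b
  · rw [Set.indicator_of_mem h, segInd]; exact if_pos h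
  · rw [Set.indicator_of_notMem h, segInd]; exact if_neg h

namespace Setup

/-! ### The good event and the error bound on one segment. -/

section Core

variable {n : ℕ} {M : Setup n} {C : NNReal} {κ φ : ℝ}

theorem ConditionD.gram_tail (h : M.ConditionD C κ φ) {a : ℝ} (ha : 0 < a)
    (haC : 4 * a * C ≤ 1) (hκ : 0 < κ) {B : Set ℝ} (hB : MeasurableSet B) (u : Fin M.p → ℝ) :
    M.P {ω | ∑ i, B.indicator 1 (M.w i ω) * (M.x i ω ⬝ᵥ u) ^ 2 <
        n * M.lawW.real B * κ / 2 * (u ⬝ᵥ u)} ≤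
      ENNReal.ofReal (Real.exp (-(n * M.lawW.real B * (κ ^ 2 * a ^ 2 / 32)))) := by
  rcases (lqNorm_nonneg 2 u).eq_or_lt with h0 | hpos
  · have hu : u ⬝ᵥ u = 0 := by rw [← lqNorm_two_sq, ← h0]; norm_num
    have : {ω | ∑ i, B.indicator 1 (M.w i ω) * (M.x i ω ⬝ᵥ u) ^ 2 <
        n * M.lawW.real B * κ / 2 * (u ⬝ᵥ u)} = ∅ := by
      refine Set.eq_empty_of_forall_notMem fun ω hω => ?_
      have hω' : ∑ i, B.indicator 1 (M.w i ω) * (M.x i ω ⬝ᵥ u) ^ 2 <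
        n * M.lawW.real B * κ / 2 * (u ⬝ᵥ u) := hω
      rw [hu, mul_zero] at hω'
      refine absurd hω' (not_lt.2 (Finset.sum_nonneg fun i _ => mul_nonneg ?_ (sq_nonneg _)))
      exact Set.indicator_nonneg (fun _ _ => zero_le_one) _
    rw [this, measure_empty]; exact zero_le
  · set N := lqNorm 2 u with hN
    have hu : lqNorm 2 (N⁻¹ • u) = 1 := by
      have h1 : lqNorm 2 (N⁻¹ • u) ^ 2 = 1 := by
        rw [lqNorm_two_sq, smul_dotProduct, dotProduct_smul, ← lqNorm_two_sq, ← hN]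
        simp only [smul_eq_mul]; field_simp
      exact (pow_eq_one_iff_of_nonneg (lqNorm_nonneg _ _) two_ne_zero).1 h1
    -- The value `t = κ a² / 8` minimizes `-t κ / 2 + 2 t² / a²`, with minimum `-κ² a² / 32`.
    refine (measure_mono fun ω hω => ?_).trans ((h.lower_tail ha haC hB hu
      (t := κ * a ^ 2 / 8) (by positivity) (n * M.lawW.real B * κ / 2)).trans_eq ?_)
    · have hω' : ∑ i, B.indicator 1 (M.w i ω) * (M.x i ω ⬝ᵥ u) ^ 2 <
        n * M.lawW.real B * κ / 2 * (u ⬝ᵥ u) := hω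
      show ∑ i, B.indicator 1 (M.w i ω) * (M.x i ω ⬝ᵥ (N⁻¹ • u)) ^ 2 ≤
        n * M.lawW.real B * κ / 2
      rw [← lqNorm_two_sq, ← hN] at hω'
      have : ∑ i, B.indicator 1 (M.w i ω) * (M.x i ω ⬝ᵥ (N⁻¹ • u)) ^ 2 =
          (∑ i, B.indicator 1 (M.w i ω) * (M.x i ω ⬝ᵥ u) ^ 2) / N ^ 2 := by
        rw [Finset.sum_div]
        refine Finset.sum_congr rfl fun i _ => ?_
        rw [dotProduct_smul, smul_eq_mul]; field_simp
      rw [this, div_le_iff₀ (by positivity)]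
      exact hω'.le
    · congr 2
      field_simp
      ring

theorem exp_mul_card_le {L m : ℝ} (hm : 0 < m) (hL : L = Real.log m) (b : ℝ) :
    ENNReal.ofReal m * ENNReal.ofReal (Real.exp b) = ENNReal.ofReal (Real.exp (L + b)) := by
  rw [← ENNReal.ofReal_mul hm.le, Real.exp_add, hL, Real.exp_log hm]

/-- On the segment `(a, b]` the regression vector is `β`, up to two exceptional pieces of mass at
most `u`, on each of which it differs from `β` by at most the maximal jump. -/
def NearlyConstant (M : Setup n) (u : ℝ) (a b : EReal) (β : Fin M.p → ℝ) : Prop :=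
  ∃ (BL BR : Set ℝ) (ηL ηR : Fin M.p → ℝ), MeasurableSet BL ∧ MeasurableSet BR ∧
    M.lawW.real BL ≤ u ∧ M.lawW.real BR ≤ u ∧ lqNorm 2 ηL ≤ M.ξmax ∧ lqNorm 2 ηR ≤ M.ξmax ∧
    ∀ i ω, M.w i ω ∈ seg a b → M.y i ω = M.x i ω ⬝ᵥ β + BL.indicator 1 (M.w i ω) *
      (M.x i ω ⬝ᵥ ηL) + BR.indicator 1 (M.w i ω) * (M.x i ω ⬝ᵥ ηR) + M.ε i ω

theorem exists_unit_smul {p : ℕ} (hp : 0 < p) (η : Fin p → ℝ) :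
    ∃ u : Fin p → ℝ, lqNorm 2 u = 1 ∧ η = lqNorm 2 η • u := by
  rcases (lqNorm_nonneg 2 η).eq_or_lt with h0 | hpos
  · refine ⟨Pi.single ⟨0, hp⟩ 1, lqNorm_two_single _, ?_⟩
    rw [← h0, zero_smul]
    have hu : η ⬝ᵥ η = 0 := by rw [← lqNorm_two_sq, ← h0]; norm_num
    exact dotProduct_self_eq_zero.1 hu
  · refine ⟨(lqNorm 2 η)⁻¹ • η, ?_, by rw [smul_smul, mul_inv_cancel₀ hpos.ne', one_smul]⟩
    have h1 : lqNorm 2 ((lqNorm 2 η)⁻¹ • η) ^ 2 = 1 := by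
      rw [lqNorm_two_sq, smul_dotProduct, dotProduct_smul, ← lqNorm_two_sq]
      simp only [smul_eq_mul]; field_simp
    exact (pow_eq_one_iff_of_nonneg (lqNorm_nonneg _ _) two_ne_zero).1 h1

/-- Union bound: five events for each coordinate, each of probability at most `p⁻²`, cost `5 / p`;
the sparse Gram bounds together cost `1 / p`, by the choice of `k`. -/
theorem ConditionD.exists_good_event (h : M.ConditionD C κ φ) {a : ℝ} (ha : 0 < a)
    (haC : 4 * a * C ≤ 1) (hκ : 0 < κ) (hn : 0 < n) (hp : 2 ≤ M.p) {A u : ℝ} (hA : 96 / a ≤ A)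
    (hlog : Real.log M.p / n ≤ 1) {I BL BR : Set ℝ} (hI : MeasurableSet I)
    (hBL : MeasurableSet BL) (hBR : MeasurableSet BR) (hBLu : M.lawW.real BL ≤ u)
    (hBRu : M.lawW.real BR ≤ u) {uL uR : Fin M.p → ℝ} (huL : lqNorm 2 uL = 1)
    (huR : lqNorm 2 uR = 1) (hdiag : 2 * Real.log M.p ≤ n * M.lawW.real I) {k : ℕ}
    (hk : (3 * k + 1) * Real.log M.p ≤ n * M.lawW.real I * (κ ^ 2 * a ^ 2 / 32)) :
    ∃ E : Set M.Ω, M.P E ≤ ENNReal.ofReal (6 * Real.exp (-1 * Real.log M.p)) ∧ ∀ ω ∉ E,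
      (∀ l, |∑ i, M.x i ω l * (I.indicator 1 (M.w i ω) * M.ε i ω)| ≤
        n * (A / 8 * √(Real.log M.p / n))) ∧
      (∀ l, ∑ i, BL.indicator 1 (M.w i ω) * |(M.x i ω ⬝ᵥ uL) * M.x i ω l| ≤
        (n * u + 2 * Real.log M.p) / a) ∧
      (∀ l, ∑ i, BR.indicator 1 (M.w i ω) * |(M.x i ω ⬝ᵥ uR) * M.x i ω l| ≤
        (n * u + 2 * Real.log M.p) / a) ∧
      (∀ l, ∑ i, I.indicator 1 (M.w i ω) * M.x i ω l ^ 2 ≤ 2 * (n * M.lawW.real I) / a) ∧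
      ∀ f : Fin k → Fin M.p × SignType,
        n * M.lawW.real I * κ / 2 * (signedSum f ⬝ᵥ signedSum f) ≤
          ∑ i, I.indicator 1 (M.w i ω) * (M.x i ω ⬝ᵥ signedSum f) ^ 2 := by
  set L := Real.log M.p with hL
  have hp0 : (0 : ℝ) < M.p := by exact_mod_cast (by omega : 0 < M.p)
  have hn0 : (0 : ℝ) < n := by exact_mod_cast hn
  have hL0 : 0 ≤ L := Real.log_nonneg (by exact_mod_cast (by omega : 1 ≤ M.p))
  set R := √(L / n) with hR
  have hR0 : 0 ≤ R := Real.sqrt_nonneg _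
  have hRR : n * (R * R) = L := by
    rw [hR, Real.mul_self_sqrt (by positivity)]; field_simp
  have hR1 : R ≤ 1 := Real.sqrt_le_one.2 hlog
  have hexp : ∀ b : ℝ, b ≤ -2 * L → ENNReal.ofReal (Real.exp b) ≤
      ENNReal.ofReal (Real.exp (-2 * L)) := fun b hb =>
    ENNReal.ofReal_le_ofReal (Real.exp_le_exp.2 hb)
  let E1 : ℝ → Fin M.p → Set M.Ω := fun σ l =>
    {ω | n * (A / 8 * R) ≤ ∑ i, M.x i ω l * (σ * (I.indicator 1 (M.w i ω) * M.ε i ω))}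
  have hE1 : ∀ σ l, |σ| = 1 → M.P (E1 σ l) ≤ ENNReal.ofReal (Real.exp (-2 * L)) := by
    intro σ l hσ
    -- The exponent becomes `(4 - A a / 16) log p`, which is at most `-2 log p` since `A a ≥ 96`.
    refine (h.noise_tail ha haC hI l hσ (θ := R / 2) (by positivity) (by linarith) _).trans
      (hexp _ ?_)
    have h1 : 96 ≤ A * a := (div_le_iff₀ ha).1 hA
    have h2 : n * (16 * (R / 2) ^ 2) - R / 2 * a * (n * (A / 8 * R)) =
      (4 - A * a / 16) * (n * (R * R)) := by ring
    rw [h2, hRR]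
    exact mul_le_mul_of_nonneg_right (by linarith) hL0
  let E2 : Set ℝ → (Fin M.p → ℝ) → Fin M.p → ℝ → Set M.Ω := fun B v l r =>
    {ω | r ≤ ∑ i, B.indicator 1 (M.w i ω) * |(M.x i ω ⬝ᵥ v) * M.x i ω l|}
  have hE2 : ∀ B v l, MeasurableSet B → lqNorm 2 v = 1 → M.lawW.real B ≤ u →
      M.P (E2 B v l ((n * u + 2 * L) / a)) ≤ ENNReal.ofReal (Real.exp (-2 * L)) := by
    intro B v l hB hv hBu
    refine (h.product_tail ha haC hB l hv _).trans (hexp _ ?_)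
    rw [mul_div_cancel₀ _ ha.ne']
    nlinarith
  have hE3 : ∀ l, M.P (E2 I (Pi.single l 1) l (2 * (n * M.lawW.real I) / a)) ≤
      ENNReal.ofReal (Real.exp (-2 * L)) := by
    intro l
    refine (h.product_tail ha haC hI l (lqNorm_two_single l) _).trans (hexp _ ?_)
    rw [mul_div_cancel₀ _ ha.ne']
    linarith
  let E4 : (Fin k → Fin M.p × SignType) → Set M.Ω := fun f =>
    {ω | ∑ i, I.indicator 1 (M.w i ω) * (M.x i ω ⬝ᵥ signedSum f) ^ 2 <
      n * M.lawW.real I * κ / 2 * (signedSum f ⬝ᵥ signedSum f)}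
  let F : Fin M.p → Set M.Ω := fun l => E1 1 l ∪ E1 (-1) l ∪
    E2 BL uL l ((n * u + 2 * L) / a) ∪ E2 BR uR l ((n * u + 2 * L) / a) ∪
    E2 I (Pi.single l 1) l (2 * (n * M.lawW.real I) / a)
  have hF : ∀ l, M.P (F l) ≤ 5 * ENNReal.ofReal (Real.exp (-2 * L)) := by
    intro l
    have h5 : ∀ e : ENNReal, 5 * e = e + e + e + e + e := fun e => by ring
    rw [h5]
    refine (measure_union_le _ _).trans (add_le_add ?_ (hE3 l))
    refine (measure_union_le _ _).trans (add_le_add ?_ (hE2 _ _ l hBR huR hBRu))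
    refine (measure_union_le _ _).trans (add_le_add ?_ (hE2 _ _ l hBL huL hBLu))
    exact (measure_union_le _ _).trans (add_le_add (hE1 _ l (by simp)) (hE1 _ l (by simp)))
  refine ⟨(⋃ l, F l) ∪ ⋃ f, E4 f, ?_, ?_⟩
  · have h1 : M.P (⋃ l, F l) ≤ ENNReal.ofReal (5 * Real.exp (-1 * L)) := by
      refine (measure_iUnion_fintype_le _ _).trans ((Finset.sum_le_sum fun l _ => hF l).trans ?_)
      rw [Finset.sum_const, Finset.card_univ, Fintype.card_fin, nsmul_eq_mul]
      rw [← ENNReal.ofReal_natCast M.p, mul_left_comm, exp_mul_card_le hp0 hL,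
        ENNReal.ofReal_mul (by norm_num)]
      have : L + -2 * L = -1 * L := by ring
      rw [this]
      simp
    have h2 : M.P (⋃ f, E4 f) ≤ ENNReal.ofReal (Real.exp (-1 * L)) := by
      refine (measure_iUnion_fintype_le _ _).trans
        ((Finset.sum_le_sum fun f _ => h.gram_tail ha haC hκ hI (signedSum f)).trans ?_)
      rw [Finset.sum_const, Finset.card_univ, nsmul_eq_mul, ← ENNReal.ofReal_natCast]
      have hcard : ((Fintype.card (Fin k → Fin M.p × SignType) : ℕ) : ℝ) ≤
          Real.exp (3 * k * L) := by
        have h3 : Fintype.card (Fin k → Fin M.p × SignType) = (M.p * 3) ^ k := by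
          rw [Fintype.card_fun, Fintype.card_prod, Fintype.card_fin, Fintype.card_fin]
          rfl
        -- `3 p ≤ p³` for `p ≥ 2`; the `3` counts the signs, zero included.
        have h4 : (M.p * 3 : ℝ) ≤ Real.exp (3 * L) := by
          have : Real.exp (3 * L) = (M.p : ℝ) ^ 3 := by
            rw [show 3 * L = ((3 : ℕ) : ℝ) * L by norm_num, Real.exp_nat_mul, hL,
              Real.exp_log hp0]
          have h2p : (2 : ℝ) ≤ M.p := by exact_mod_cast hp
          rw [this]; nlinarith [mul_pos hp0 hp0]
        rw [h3]
        push_cast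
        calc (M.p * 3 : ℝ) ^ k ≤ Real.exp (3 * L) ^ k := by gcongr
          _ = _ := by rw [← Real.exp_nat_mul]; ring_nf
      rw [← ENNReal.ofReal_mul (by positivity)]
      refine ENNReal.ofReal_le_ofReal ?_
      refine (mul_le_mul_of_nonneg_right hcard (Real.exp_pos _).le).trans ?_
      rw [← Real.exp_add, Real.exp_le_exp]
      linarith
    refine (measure_union_le _ _).trans ((add_le_add h1 h2).trans_eq ?_)
    rw [← ENNReal.ofReal_add (by positivity) (by positivity)]
    congr 1; ring
  · intro ω hω
    simp only [Set.mem_union, Set.mem_iUnion, not_or, not_exists, F, E1, E2, E4, Set.mem_ofPred_eq,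
      not_le, not_lt] at hω
    obtain ⟨hF', hE4⟩ := hω
    refine ⟨fun l => ?_, fun l => ?_, fun l => ?_, fun l => ?_, hE4⟩ <;>
      obtain ⟨⟨⟨⟨h1, h2⟩, h3⟩, h4⟩, h5⟩ := hF' l
    · simp only [one_mul, neg_mul, mul_neg, Finset.sum_neg_distrib] at h1 h2
      exact abs_le.2 ⟨by linarith, h1.le⟩
    · exact h3.le
    · exact h4.le
    · refine le_trans (le_of_eq (Finset.sum_congr rfl fun i _ => ?_)) h5.le
      rw [dotProduct_single, mul_one, ← sq, abs_of_nonneg (sq_nonneg _)]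

theorem ConditionD.errorBound (h : M.ConditionD C κ φ) {a : ℝ} (ha : 0 < a)
    (haC : 4 * a * C ≤ 1) (hκ : 0 < κ) (hn : 0 < n) {A cu k cH : ℝ} (hcH : 0 < cH)
    (hA : (96 + 16 * (1 + 2 * cH)) / a ≤ A)
    (hlog : Real.log M.p / n ≤ 1)
    (hE : M.ξmax * √(Real.log M.p / n) ≤ cH ∨ Real.log M.p / n ≤ cH * M.ucheck cu k)
    (hsp : M.Sparse) {K : ℕ} (hK : 128 / (a * κ) ≤ K)
    (hlmin : 0 < M.lmin)
    (hn1 : 2 * Real.log M.p ≤ n * M.lmin)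
    (hn2 : (3 * (K * M.s + 1 : ℕ) + 1) * Real.log M.p ≤ n * M.lmin * (κ ^ 2 * a ^ 2 / 32))
    {b₁ b₂ : EReal} (hmass : M.lmin ≤ M.lawW.real (seg b₁ b₂)) {j : Fin (M.N + 1)}
    (hnear : M.NearlyConstant (M.ucheck cu k) b₁ b₂ (M.β₀ j)) {α : M.Ω → Fin M.p → ℝ}
    (hα : ∀ ω, IsLasso (fun i => M.y i ω) (fun i => M.x i ω) (fun i => M.w i ω) b₁ b₂
      (A * M.rate cu k) (α ω)) {q : ℝ} (hq : q = 1 ∨ q = 2) :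
    M.ErrorBound (24 * A / κ) 6 1 (M.rate cu k) q (α) (M.β₀ j) := by
  have hn0 : (0 : ℝ) < n := by exact_mod_cast hn
  have hA0 : 0 < A := lt_of_lt_of_le (by positivity) hA
  -- For `p ≤ 1` the logarithm vanishes and the claimed probability bound is `6`.
  rcases Nat.lt_or_ge M.p 2 with hp | hp
  · have hlog0 : Real.log M.p = 0 := by
      obtain h0 | h1 : M.p = 0 ∨ M.p = 1 := by omega
      · simp [h0]
      · simp [h1]
    refine prob_le_one.trans ?_
    rw [hlog0, mul_zero, Real.exp_zero, mul_one]
    exact ENNReal.one_le_ofReal.2 (by norm_num)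
  obtain ⟨BL, BR, ηL, ηR, hBL, hBR, hBLu, hBRu, hηL, hηR, hy⟩ := hnear
  obtain ⟨uL, huL, hηL'⟩ := exists_unit_smul (by omega) ηL
  obtain ⟨uR, huR, hηR'⟩ := exists_unit_smul (by omega) ηR
  set I := seg b₁ b₂ with hI
  have hImeas : MeasurableSet I := measurableSet_seg _ _
  set L := Real.log M.p with hL
  have hLpos : 0 < L := Real.log_pos (by exact_mod_cast hp)
  set ν := M.lawW.real I with hν
  have hνpos : 0 < ν := hlmin.trans_le hmass
  have hA96 : 96 / a ≤ A := le_trans (by gcongr; linarith) hA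
  obtain ⟨E, hEP, hgood⟩ := h.exists_good_event ha haC hκ hn hp hA96 hlog hImeas hBL hBR hBLu hBRu
    huL huR (hn1.trans (by gcongr)) (k := K * M.s + 1) (hn2.trans (by gcongr))
  refine (measure_mono ?_).trans hEP
  intro ω hω
  by_contra hωE
  apply hω
  obtain ⟨g1, g2, g3, g4, g5⟩ := hgood ω hωE
  set R := M.rate cu k with hR
  set U := M.ucheck cu k with hU
  have hRpos : 0 < R := lt_of_lt_of_le (Real.sqrt_pos.2 (by positivity)) (le_max_left _ _)
  have hR1 : √(L / n) ≤ R := le_max_left _ _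
  have hR2 : M.ξmax * U ≤ R := le_max_right _ _
  have hξ : 0 ≤ M.ξmax := (lqNorm_nonneg _ _).trans hηL
  have hs1 : (1 : ℝ) ≤ M.s := by exact_mod_cast hsp.one_le_s
  -- Either alternative of (E) bounds the deviation part of the misspecification by the rate.
  have hξL : M.ξmax * (L / n) ≤ cH * R := by
    rcases hE with hE | hE
    · calc M.ξmax * (L / n) = (M.ξmax * √(L / n)) * √(L / n) := by
            rw [mul_assoc, Real.mul_self_sqrt (by positivity)]
        _ ≤ cH * R := by gcongr
    · calc M.ξmax * (L / n) ≤ M.ξmax * (cH * U) := by gcongr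
        _ = cH * (M.ξmax * U) := by ring
        _ ≤ cH * R := by gcongr
  have hpiece : ∀ (B : Set ℝ) (η v : Fin M.p → ℝ) (l : Fin M.p), η = lqNorm 2 η • v →
      lqNorm 2 η ≤ M.ξmax →
      ∑ i, B.indicator 1 (M.w i ω) * |(M.x i ω ⬝ᵥ v) * M.x i ω l| ≤ (n * U + 2 * L) / a →
      |∑ i, 1 / (n : ℝ) * I.indicator 1 (M.w i ω) * (B.indicator 1 (M.w i ω) *
        (M.x i ω ⬝ᵥ η) * M.x i ω l)| ≤ (1 + 2 * cH) / a * R := by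
    intro B η v l hη hηle hsum
    have h1 : |∑ i, 1 / (n : ℝ) * I.indicator 1 (M.w i ω) * (B.indicator 1 (M.w i ω) *
        (M.x i ω ⬝ᵥ η) * M.x i ω l)| ≤ M.ξmax / n *
        ∑ i, B.indicator 1 (M.w i ω) * |(M.x i ω ⬝ᵥ v) * M.x i ω l| := by
      rw [Finset.mul_sum]
      refine (Finset.abs_sum_le_sum_abs _ _).trans (Finset.sum_le_sum fun i _ => ?_)
      rw [hη, dotProduct_smul, smul_eq_mul]
      have h2 : 0 ≤ M.ξmax / n * |(M.x i ω ⬝ᵥ v) * M.x i ω l| := by positivity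
      by_cases hB : M.w i ω ∈ B
      · by_cases hI' : M.w i ω ∈ I
        · simp only [hB, hI', Set.indicator_of_mem, Pi.one_apply, mul_one, one_mul]
          rw [mul_assoc (lqNorm 2 η), ← mul_assoc, abs_mul, abs_of_nonneg
            (mul_nonneg (by positivity) (lqNorm_nonneg 2 η)), one_div_mul_eq_div]
          gcongr
        · simp only [hB, hI', Set.indicator_of_mem, Set.indicator_of_notMem, not_false_eq_true,
            Pi.one_apply, mul_zero, zero_mul, one_mul, abs_zero]
          exact h2
      · simp [hB]
    refine h1.trans ?_
    calc M.ξmax / n * ∑ i, B.indicator 1 (M.w i ω) * |(M.x i ω ⬝ᵥ v) * M.x i ω l|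
        ≤ M.ξmax / n * ((n * U + 2 * L) / a) := by gcongr
      _ = (M.ξmax * U + 2 * (M.ξmax * (L / n))) / a := by field_simp
      _ ≤ (R + 2 * (cH * R)) / a := by gcongr
      _ = _ := by ring
  classical
  set S : Finset (Fin M.p) := M.S.toFinset with hS
  have hScard : (S.card : ℝ) ≤ M.s := by
    rw [hS, ← Set.ncard_eq_toFinset_card']; exact_mod_cast hsp.card_le
  have hβ : ∀ l, l ∉ S → M.β₀ j l = 0 := by
    intro l hl
    by_contra h0
    exact hl (by rw [hS, Set.mem_toFinset]; exact ⟨j, h0⟩)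
  have hscore : ∀ l, |∑ i, 1 / (n : ℝ) * segInd b₁ b₂ (M.w i ω) *
      ((M.y i ω - M.x i ω ⬝ᵥ M.β₀ j) * M.x i ω l)| ≤ A * R / 4 := by
    intro l
    have hsplit : ∑ i, 1 / (n : ℝ) * segInd b₁ b₂ (M.w i ω) *
        ((M.y i ω - M.x i ω ⬝ᵥ M.β₀ j) * M.x i ω l) =
        1 / n * ∑ i, M.x i ω l * (I.indicator 1 (M.w i ω) * M.ε i ω) +
        ∑ i, 1 / (n : ℝ) * I.indicator 1 (M.w i ω) * (BL.indicator 1 (M.w i ω) *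
          (M.x i ω ⬝ᵥ ηL) * M.x i ω l) +
        ∑ i, 1 / (n : ℝ) * I.indicator 1 (M.w i ω) * (BR.indicator 1 (M.w i ω) *
          (M.x i ω ⬝ᵥ ηR) * M.x i ω l) := by
      rw [Finset.mul_sum, ← Finset.sum_add_distrib, ← Finset.sum_add_distrib]
      refine Finset.sum_congr rfl fun i _ => ?_
      rw [segInd_eq, ← hI]
      by_cases hI' : M.w i ω ∈ I
      · rw [hy i ω hI']; simp only [hI', Set.indicator_of_mem, Pi.one_apply]; ring
      · simp [hI']
    have hnoise : |1 / n * ∑ i, M.x i ω l * (I.indicator 1 (M.w i ω) * M.ε i ω)| ≤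
        A / 8 * R := by
      rw [abs_mul, abs_of_nonneg (by positivity)]
      calc 1 / (n : ℝ) * |∑ i, M.x i ω l * (I.indicator 1 (M.w i ω) * M.ε i ω)|
          ≤ 1 / n * (n * (A / 8 * √(L / n))) := by gcongr; exact g1 l
        _ = A / 8 * √(L / n) := by field_simp
        _ ≤ A / 8 * R := by gcongr
    -- Score budget: `A / 8` for the noise and `A / 16` for each end piece, in total `A / 4`.
    have hA' : (1 + 2 * cH) / a ≤ A / 16 := by
      rw [div_le_iff₀ ha] at hA ⊢; linarith
    have hA'' : (1 + 2 * cH) / a * R ≤ A / 16 * R := by gcongr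
    rw [hsplit]
    refine (abs_add_three _ _ _).trans ?_
    have := hpiece BL ηL uL l hηL' hηL (g2 l)
    have := hpiece BR ηR uR l hηR' hηR (g3 l)
    linarith
  have hc : ∀ i, 1 / (n : ℝ) * segInd b₁ b₂ (M.w i ω) =
      1 / (n : ℝ) * I.indicator 1 (M.w i ω) := fun i => by rw [segInd_eq]
  have hK0 : (0 : ℝ) < K := lt_of_lt_of_le (by positivity) hK
  have hRE : ∀ v : Fin M.p → ℝ, ∑ l, |v l| ≤ 4 * ∑ l ∈ S, |v l| →
      M.lmin * κ / 4 * (v ⬝ᵥ v) ≤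
        gram (fun i => 1 / (n : ℝ) * segInd b₁ b₂ (M.w i ω)) (fun i => M.x i ω) v := by
    intro v hv
    have hk2 : 2 ≤ K * M.s + 1 := by
      have : 0 < K * M.s := Nat.mul_pos (by exact_mod_cast hK0) hsp.one_le_s
      omega
    have h1 := gram_lower_bound (fun i => 1 / (n : ℝ) * segInd b₁ b₂ (M.w i ω))
      (fun i => M.x i ω) (θ := ν * κ / 2) (D := 2 * ν / a) (by positivity) hk2
      (fun f => ?_) (fun l => ?_) v
    · have hvv := dotProduct_self_nonneg' v
      have hl1 : (∑ l, |v l|) ^ 2 ≤ 16 * M.s * (v ⬝ᵥ v) := by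
        have h2 := sum_abs_le_sqrt_mul S hScard v
        calc (∑ l, |v l|) ^ 2 ≤ (4 * (√M.s * √(v ⬝ᵥ v))) ^ 2 := by
              refine pow_le_pow_left₀ (Finset.sum_nonneg fun _ _ => abs_nonneg _) ?_ 2
              linarith
          _ = _ := by
            rw [mul_pow, mul_pow, Real.sq_sqrt (by positivity), Real.sq_sqrt hvv]; ring
      -- With `k - 1 = K s`, Maurey's error is at most `32 ν / (a K) ‖v‖²`. The choice `K ≥ 128 / (a
      -- κ)` makes this half of the sparse curvature `ν κ / 2`.
      have h3 : (∑ l, |v l|) ^ 2 * (2 * ν / a) / (((K * M.s + 1 : ℕ) : ℝ) - 1) ≤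
          ν * κ / 4 * (v ⬝ᵥ v) := by
        push_cast
        rw [add_sub_cancel_right, div_le_iff₀ (by positivity)]
        calc (∑ l, |v l|) ^ 2 * (2 * ν / a) ≤ 16 * M.s * (v ⬝ᵥ v) * (2 * ν / a) := by gcongr
          _ = (128 / (a * κ)) * (ν * κ / 4 * (v ⬝ᵥ v) * M.s) := by field_simp; ring
          _ ≤ K * (ν * κ / 4 * (v ⬝ᵥ v) * M.s) := by gcongr
          _ = _ := by ring
      have h4 : M.lmin * κ / 4 * (v ⬝ᵥ v) ≤ ν * κ / 4 * (v ⬝ᵥ v) := by gcongr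
      linarith
    · have h2 := g5 f
      simp only [gram]
      simp_rw [hc, mul_assoc]
      rw [← Finset.mul_sum, one_div, inv_mul_eq_div, le_div_iff₀ hn0]
      refine le_trans (le_of_eq ?_) h2
      ring
    · have h2 := g4 l
      simp_rw [hc, mul_assoc]
      rw [← Finset.mul_sum, one_div, inv_mul_eq_div, div_le_iff₀ hn0]
      refine h2.trans (le_of_eq ?_)
      ring
  obtain ⟨hb1, hb2⟩ := lasso_error_bound (hα ω) (by positivity) S hβ hScard
    (θ := M.lmin * κ / 4) (by positivity) hscore hRE
  rcases hq with rfl | rfl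
  · refine hb1.trans (le_of_eq ?_)
    rw [one_div_one, Real.rpow_one]; field_simp; ring
  · refine hb2.trans ?_
    rw [← Real.sqrt_eq_rpow]
    have : 3 / 2 * √M.s * (A * R) / (M.lmin * κ / 4) = 6 * A / κ * √M.s * R / M.lmin := by
      field_simp; ring
    rw [this]
    gcongr
    norm_num

end Core

end Setup

/-! ### Extended grids and the cdf scale. -/

section Grid

variable {K : ℕ} {τ : Fin K → ℝ}

theorem extendGrid_zero (τ : Fin K → ℝ) : extendGrid τ 0 = ⊥ := rfl

theorem extendGrid_last (τ : Fin K → ℝ) : extendGrid τ (Fin.last (K + 1)) = ⊤ := by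
  rw [extendGrid, ← Fin.succ_last, Fin.cons_succ, Fin.snoc_last]

theorem extendGrid_castSucc_succ (τ : Fin K → ℝ) (i : Fin K) :
    extendGrid τ i.castSucc.succ = τ i := by
  rw [extendGrid, Fin.cons_succ, Fin.snoc_castSucc]

theorem monotone_extendGrid (h : Monotone τ) : Monotone (extendGrid τ) := by
  rw [Fin.monotone_iff_le_succ]
  intro i
  induction i using Fin.cases with
  | zero => rw [Fin.castSucc_zero, extendGrid_zero]; exact bot_le
  | succ i =>
    rw [Fin.castSucc_succ, extendGrid_castSucc_succ]
    rcases Fin.eq_castSucc_or_eq_last i.succ with ⟨i', hi'⟩ | hi'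
    · rw [hi', extendGrid_castSucc_succ, EReal.coe_le_coe_iff]
      refine h ?_
      rw [← Fin.castSucc_le_castSucc_iff, ← hi']
      exact Fin.castSucc_le_succ i
    · rw [hi', Fin.succ_last, extendGrid_last]; exact le_top

variable {ν : Measure ℝ} [IsProbabilityMeasure ν]

theorem monotone_cdfE : Monotone (cdfE ν) := fun _ _ hab =>
  measureReal_mono fun _ hu => le_trans hu hab

theorem real_seg_eq {a b : EReal} (hab : a ≤ b) : ν.real (seg a b) = cdfE ν b - cdfE ν a := by
  have hsub : {u : ℝ | (u : EReal) ≤ a} ⊆ {u : ℝ | (u : EReal) ≤ b} := fun _ hu => le_trans hu hab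
  rw [cdfE, cdfE, ← measureReal_sdiff hsub
    (measurableSet_le measurable_coe_real_ereal measurable_const)]
  congr 1
  ext t
  simp only [seg, Set.mem_ofPred_eq, Set.mem_sdiff, not_le]
  exact and_comm

theorem real_seg_le {a b : EReal} {u : ℝ} (hu : 0 ≤ u) (h : cdfE ν b - cdfE ν a ≤ u) :
    ν.real (seg a b) ≤ u := by
  rcases le_total a b with hab | hab
  · rwa [real_seg_eq hab]
  · have : seg a b = ∅ := Set.eq_empty_of_forall_notMem fun t ht =>
      absurd (ht.1.trans_le ht.2) hab.not_gt
    rw [this, measureReal_empty]; exact hu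

end Grid

/-! ### Interlacing of initializers and change points. -/

namespace Setup

variable {n : ℕ} (M : Setup n)

theorem lqNorm_sub_comm {p : ℕ} (q : ℝ) (u v : Fin p → ℝ) :
    lqNorm q (u - v) = lqNorm q (v - u) := by
  simp only [lqNorm, Pi.sub_apply, abs_sub_comm]

theorem lqNorm_two_zero {p : ℕ} : lqNorm 2 (0 : Fin p → ℝ) = 0 := by
  rw [lqNorm_two]; simp

theorem ξmax_nonneg : 0 ≤ M.ξmax := Real.iSup_nonneg fun _ => lqNorm_nonneg _ _

theorem jump_le_ξmax (j : Fin M.N) : M.jump j ≤ M.ξmax :=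
  le_ciSup (Set.finite_range M.jump).bddAbove j

theorem one_le_ρ (h : ∀ j, 0 < M.jump j) : 1 ≤ M.ρ := by
  unfold ρ
  split_ifs with hN
  · exact le_rfl
  · have : Nonempty (Fin M.N) := ⟨⟨0, Nat.pos_of_ne_zero hN⟩⟩
    obtain ⟨j, hj⟩ := exists_eq_ciInf_of_finite (f := M.jump)
    have hmin : 0 < M.ξmin := by unfold ξmin; rw [← hj]; exact h j
    rw [one_le_div hmin]
    calc M.ξmin = M.jump j := hj.symm
      _ ≤ M.ξmax := M.jump_le_ξmax j

theorem y_of_mem_seg {i : Fin n} {ω : M.Ω} {r : Fin (M.N + 1)}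
    (h : M.w i ω ∈ seg (extendGrid M.τ₀ r.castSucc) (extendGrid M.τ₀ r.succ)) :
    M.y i ω = M.x i ω ⬝ᵥ M.β₀ r + M.ε i ω := by
  have hT := monotone_extendGrid M.strictMono_τ₀.monotone
  rw [y, Finset.sum_eq_single r]
  · rw [segInd_eq, Set.indicator_of_mem h, Pi.one_apply, mul_one]
  · intro j _ hj
    rw [segInd_eq, Set.indicator_of_notMem, mul_zero]
    intro hj'
    rcases hj.lt_or_gt with hlt | hlt
    · exact absurd (h.1.trans_le (hj'.2.trans (hT (Fin.succ_le_castSucc_iff.2 hlt)))) (lt_irrefl _)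
    · exact absurd (hj'.1.trans_le (h.2.trans (hT (Fin.succ_le_castSucc_iff.2 hlt)))) (lt_irrefl _)
  · intro h0; exact absurd (Finset.mem_univ r) h0

/-- The initializers are so close to the change points that they interlace with them. -/
structure Interlaced (u : ℝ) : Prop where
  nonneg : 0 ≤ u
  lt_lmin : u < M.lmin
  gap_check : ∀ i : Fin (M.Ncheck + 1), M.lmin < cdfE M.lawW (extendGrid M.τcheck i.succ) -
    cdfE M.lawW (extendGrid M.τcheck i.castSucc)
  gap : ∀ j : Fin M.N, u < cdfE M.lawW (extendGrid M.τ₀ j.castSucc.succ) -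
    cdfE M.lawW (extendGrid M.τ₀ j.castSucc.castSucc)
  close : ∀ r, |cdfE M.lawW (extendGrid M.τ₀ r) - cdfE M.lawW (extendGrid M.τcheck (M.m r))| ≤ u

variable {M} {u : ℝ}

/-- The exceptional pieces run from the left end of the segment to `τ⁰_l` and from `τ⁰_{l+1}` to its
right end (empty if reversed). Closeness bounds their mass; true gaps larger than `u` keep the
segment from reaching past the adjacent regimes. -/
theorem Interlaced.nearlyConstant [IsProbabilityMeasure M.lawW] (h : M.Interlaced u)
    {i : Fin (M.Ncheck + 1)} {l : Fin (M.N + 1)} (h1 : M.m l.castSucc ≤ i.castSucc)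
    (h2 : i.succ ≤ M.m l.succ) :
    M.NearlyConstant u (extendGrid M.τcheck i.castSucc) (extendGrid M.τcheck i.succ) (M.β₀ l) := by
  have hT := monotone_extendGrid M.strictMono_τ₀.monotone
  have hc := monotone_extendGrid M.monotone_τcheck
  have hF := monotone_cdfE (ν := M.lawW)
  have hL := (abs_le.1 (h.close l.castSucc)).2
  have hR := (abs_le.1 (h.close l.succ)).1
  have hFL := hF (hc h1)
  have hFR := hF (hc h2)
  set a := extendGrid M.τcheck i.castSucc
  set b := extendGrid M.τcheck i.succ
  have hleft : ∃ η : Fin M.p → ℝ, lqNorm 2 η ≤ M.ξmax ∧ ∀ i ω, a < M.w i ω →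
      (M.w i ω : EReal) ≤ extendGrid M.τ₀ l.castSucc →
      M.y i ω = M.x i ω ⬝ᵥ M.β₀ l + M.x i ω ⬝ᵥ η + M.ε i ω := by
    rcases Fin.eq_zero_or_eq_succ l with rfl | ⟨l', rfl⟩
    · refine ⟨0, by rw [lqNorm_two_zero]; exact M.ξmax_nonneg, fun i ω _ hw => ?_⟩
      rw [Fin.castSucc_zero, extendGrid_zero, le_bot_iff] at hw
      exact absurd hw (EReal.coe_ne_bot _)
    · refine ⟨M.β₀ l'.castSucc - M.β₀ l'.succ, ?_, fun i ω hw1 hw2 => ?_⟩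
      · rw [lqNorm_sub_comm]; exact M.jump_le_ξmax l'
      · have hlt : extendGrid M.τ₀ l'.castSucc.castSucc < a := by
          refine hF.reflect_lt ?_
          have := h.gap l'
          rw [← Fin.castSucc_succ] at this
          linarith
        rw [M.y_of_mem_seg (r := l'.castSucc) ⟨hlt.trans hw1, hw2⟩, dotProduct_sub]
        ring
  have hright : ∃ η : Fin M.p → ℝ, lqNorm 2 η ≤ M.ξmax ∧ ∀ i ω,
      extendGrid M.τ₀ l.succ < M.w i ω → (M.w i ω : EReal) ≤ b →
      M.y i ω = M.x i ω ⬝ᵥ M.β₀ l + M.x i ω ⬝ᵥ η + M.ε i ω := by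
    rcases Fin.eq_castSucc_or_eq_last l with ⟨l', rfl⟩ | rfl
    · refine ⟨M.β₀ l'.succ - M.β₀ l'.castSucc, M.jump_le_ξmax l', fun i ω hw1 hw2 => ?_⟩
      have hle : b ≤ extendGrid M.τ₀ l'.succ.succ := by
        -- The gap bound does not cover the last true segment, but its right end is `∞`.
        rcases Fin.eq_castSucc_or_eq_last l'.succ with ⟨l'', hl''⟩ | hl''
        · refine (hF.reflect_lt ?_).le
          have := h.gap l''
          rw [← hl'', Fin.castSucc_succ] at this
          linarith
        · rw [hl'', Fin.succ_last, extendGrid_last]; exact le_top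
      rw [M.y_of_mem_seg (r := l'.succ) ⟨hw1, hw2.trans hle⟩, dotProduct_sub]
      ring
    · refine ⟨0, by rw [lqNorm_two_zero]; exact M.ξmax_nonneg, fun i ω hw _ => ?_⟩
      rw [Fin.succ_last, extendGrid_last] at hw
      exact absurd hw not_top_lt
  obtain ⟨ηL, hηL, hyL⟩ := hleft
  obtain ⟨ηR, hηR, hyR⟩ := hright
  refine ⟨seg a (extendGrid M.τ₀ l.castSucc), seg (extendGrid M.τ₀ l.succ) b, ηL, ηR,
    measurableSet_seg _ _, measurableSet_seg _ _, real_seg_le h.nonneg (by linarith),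
    real_seg_le h.nonneg (by linarith), hηL, hηR, fun i ω hw => ?_⟩
  have hlo : extendGrid M.τ₀ l.castSucc ≤ extendGrid M.τ₀ l.succ := hT (Fin.castSucc_le_succ l)
  rcases le_or_gt (M.w i ω : EReal) (extendGrid M.τ₀ l.castSucc) with hl | hl
  · have hnr : M.w i ω ∉ seg (extendGrid M.τ₀ l.succ) b := fun hm =>
      absurd (hm.1.trans_le (hl.trans hlo)) (lt_irrefl _)
    have hml : M.w i ω ∈ seg a (extendGrid M.τ₀ l.castSucc) := ⟨hw.1, hl⟩
    rw [Set.indicator_of_notMem hnr, Set.indicator_of_mem hml, hyL i ω hw.1 hl, Pi.one_apply]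
    ring
  · have hnl : M.w i ω ∉ seg a (extendGrid M.τ₀ l.castSucc) := fun hm => hm.2.not_gt hl
    rw [Set.indicator_of_notMem hnl]
    rcases le_or_gt (M.w i ω : EReal) (extendGrid M.τ₀ l.succ) with hr | hr
    · have hnr : M.w i ω ∉ seg (extendGrid M.τ₀ l.succ) b := fun hm => hm.1.not_ge hr
      rw [Set.indicator_of_notMem hnr, M.y_of_mem_seg ⟨hl, hr⟩]
      ring
    · have hmr : M.w i ω ∈ seg (extendGrid M.τ₀ l.succ) b := ⟨hr, hw.2⟩
      rw [Set.indicator_of_mem hmr, hyR i ω hr hw.2, Pi.one_apply]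
      ring

/-- An unmatched initializer lies more than `l_min > u` in cdf scale from the matched ones on either
side, while the corresponding change points are within `u` of those. Since the cdf is monotone,
strict inequalities between its values pass to the points. -/
theorem Interlaced.isSegmentOf [IsProbabilityMeasure M.lawW] (h : M.Interlaced u)
    {i : Fin (M.Ncheck + 1)} {l : Fin (M.N + 1)} (h1 : M.m l.castSucc ≤ i.castSucc)
    (h2 : i.succ < M.m l.succ) : M.IsSegmentOf i.succ l := by
  have hT := monotone_extendGrid M.strictMono_τ₀.monotone
  have hc := monotone_extendGrid M.monotone_τcheck
  have hF := monotone_cdfE (ν := M.lawW)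
  have hL := (abs_le.1 (h.close l.castSucc)).2
  have hR := (abs_le.1 (h.close l.succ)).1
  have hu := h.lt_lmin
  have hlow : extendGrid M.τ₀ l.castSucc < extendGrid M.τcheck i.succ := by
    refine hF.reflect_lt ?_
    have := h.gap_check i
    have := hF (hc h1)
    have := h.nonneg
    linarith
  refine ⟨⟨hlow, (hF.reflect_lt ?_).le⟩, fun r hr => ?_⟩
  · obtain ⟨i', hi'⟩ | hi' := Fin.eq_castSucc_or_eq_last i.succ
    · rw [hi'] at h2 ⊢
      have := h.gap_check i'
      have := hF (hc (Fin.castSucc_lt_iff_succ_le.1 h2))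
      linarith
    · rw [hi'] at h2
      exact absurd h2 (Fin.le_last _).not_gt
  · by_contra! hlt
    exact absurd (hlow.trans_le (hr.2.trans (hT (Fin.succ_le_castSucc_iff.2 hlt)))) (lt_irrefl _)

/-- Otherwise induction along `m` keeps every `m r` below `i.succ`, which the last index
contradicts. -/
theorem exists_between {i : Fin (M.Ncheck + 1)} (h0 : M.m 0 = 0)
    (hlast : M.m (Fin.last (M.N + 1)) = Fin.last (M.Ncheck + 1))
    (hi : i.succ ∉ Set.range M.m) :
    ∃ l : Fin (M.N + 1), M.m l.castSucc ≤ i.castSucc ∧ i.succ < M.m l.succ := by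
  by_contra! hcon
  have hall : ∀ r : Fin (M.N + 2), M.m r < i.succ := by
    intro r
    induction r using Fin.induction with
    | zero => rw [h0]; exact Fin.succ_pos i
    | succ r ih =>
      refine lt_of_le_of_ne (hcon r (Fin.le_castSucc_iff.2 ih)) fun h => hi ⟨_, h⟩
  have := hall (Fin.last _)
  rw [hlast] at this
  exact absurd this (Fin.le_last _).not_gt

/-- For `N = 0` the rate condition does not compare `ǔ_n` with `l_min`. The matched points are then
only `±∞`, with distance `0`, so `u = 0` serves. -/
theorem ConditionA.interlaced [IsProbabilityMeasure M.lawW] {cN cu k cS : ℝ}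
    (hA : M.ConditionA cN cu k) (hS : M.SeparatedChanges cS) (hu0 : 0 ≤ M.ucheck cu k)
    (hu : M.N ≠ 0 → M.ucheck cu k < M.lmin ∧ M.ucheck cu k < cS * M.lmin) :
    M.Interlaced (if M.N = 0 then 0 else M.ucheck cu k) := by
  have hT := monotone_extendGrid M.strictMono_τ₀.monotone
  have hc := monotone_extendGrid M.monotone_τcheck
  have hF := monotone_cdfE (ν := M.lawW)
  have hU : 0 ≤ if M.N = 0 then 0 else M.ucheck cu k := by split_ifs <;> simp [hu0]
  refine ⟨hU, ?_, fun i => ?_, fun j => ?_, fun r => ?_⟩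
  · split_ifs with hN
    · exact hA.lmin_pos
    · exact (hu hN).1
  · have := hA.separated i
    rwa [d, cdfDist, abs_of_nonneg (sub_nonneg.2 (hF (hc (Fin.castSucc_le_succ i))))] at this
  · have hN : M.N ≠ 0 := fun h => by have := j.2; omega
    have := hS.separated j
    rw [d, cdfDist, abs_of_nonneg (sub_nonneg.2 (hF (hT (Fin.castSucc_le_succ _))))] at this
    rw [if_neg hN]
    exact (hu hN).2.trans_le this
  · induction r using Fin.cases with
    | zero => rw [hA.m_zero, extendGrid_zero, extendGrid_zero]; simpa using hU
    | succ r =>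
      rcases Fin.eq_castSucc_or_eq_last r with ⟨r, rfl⟩ | rfl
      · have hN : M.N ≠ 0 := fun h => by have := r.2; omega
        rw [if_neg hN]
        exact hA.close r
      · rw [Fin.succ_last, hA.m_last, extendGrid_last, extendGrid_last]; simpa using hU

theorem NearlyConstant.mono {u' : ℝ} (huu : u ≤ u') {a b : EReal} {β : Fin M.p → ℝ}
    (h : M.NearlyConstant u a b β) : M.NearlyConstant u' a b β := by
  obtain ⟨BL, BR, ηL, ηR, h1, h2, h3, h4, h5⟩ := h
  exact ⟨BL, BR, ηL, ηR, h1, h2, h3.trans huu, h4.trans huu, h5⟩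

end Setup

end ChangePoint

end

/-! ### Choice of constants and the asymptotic statement. -/

theorem mainTheorem5 (C : NNReal) (κ φ cH : ℝ) (hκ : 0 < κ) (hφ : 0 < φ) (hcH : 0 < cH) :
    ∃ A₀ : ℝ, 0 < A₀ ∧ ∀ A : ℝ, A₀ ≤ A →
    ∃ c c₁ c₂ : ℝ, 0 < c ∧ 0 < c₁ ∧ 0 < c₂ ∧
    ∀ (cN cu k cS : ℝ), 1 ≤ cN → 0 < cu → 1 ≤ k → 0 < cS →
    ∀ M : (n : ℕ) → ChangePoint.Setup n,
      (∀ᶠ n in atTop, (M n).ConditionA cN cu k) →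
      (∀ᶠ n in atTop, (M n).Sparse) →
      Tendsto (fun n : ℕ => (M n).s * Real.log (M n).p / (n * (M n).lmin ^ 2)) atTop (𝓝 0) →
      (∀ᶠ n in atTop, (M n).SeparatedChanges cS) →
      Tendsto (fun n : ℕ => (M n).N * (M n).ρ * (M n).ucheck cu k / (M n).lmin) atTop (𝓝 0) →
      (∀ᶠ n in atTop, (M n).ConditionD C κ φ) →
      (∀ᶠ n : ℕ in atTop, (M n).ξmax * √(Real.log (M n).p / n) ≤ cH ∨
        Real.log (M n).p / n ≤ cH * (M n).ucheck cu k) →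
      ∀ᶠ n in atTop, ∀ α : Fin ((M n).Ncheck + 1) → (M n).Ω → Fin (M n).p → ℝ,
        (M n).IsStepZero (A * (M n).rate cu k) α →
        ∀ q : ℝ, q = 1 ∨ q = 2 →
          (∀ (j : Fin ((M n).N + 1)) (i : Fin ((M n).Ncheck + 1)), (M n).m j.succ = i.succ →
            (M n).ErrorBound c c₁ c₂ ((M n).rate cu k) q (α i) ((M n).β₀ j)) ∧
          (∀ i : Fin ((M n).Ncheck + 1), i.succ ∉ Set.range (M n).m →
            ∃ l : Fin ((M n).N + 1), (M n).IsSegmentOf i.succ l ∧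
              (M n).ErrorBound c c₁ c₂ ((M n).rate cu k) q (α i) ((M n).β₀ l)) := by
  -- `C + 1` instead of `C` keeps `a` finite and positive when `C = 0`.
  set a : ℝ := 1 / (4 * (C + 1)) with ha_def
  have hC0 : (0 : ℝ) ≤ C := C.2
  have ha : 0 < a := by positivity
  have haC : 4 * a * C ≤ 1 := by
    rw [ha_def, mul_one_div, div_mul_eq_mul_div, div_le_one (by positivity)]
    linarith
  refine ⟨(96 + 16 * (1 + 2 * cH)) / a, by positivity, fun A hA => ?_⟩
  have hA0 : 0 < A := lt_of_lt_of_le (by positivity) hA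
  refine ⟨24 * A / κ, 6, 1, by positivity, by norm_num, one_pos, ?_⟩
  intro cN cu k cS _ hcu _ hcS M hCA hSp hslog hSep hNρ hCD hE
  obtain ⟨K, hK⟩ := exists_nat_ge (128 / (a * κ))
  set e : ℝ := κ ^ 2 * a ^ 2 / 32 with he_def
  have he : 0 < e := by positivity
  -- The first entry gives `2 log p ≤ n l_min`. The second pays for the union over signed sums with
  -- `k = K s + 1`, as `3 k + 1 ≤ (3 K + 4) s`.
  set δ : ℝ := min (1 / 2) (e / (3 * K + 4)) with hδ_def
  have hδ : 0 < δ := by positivity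
  filter_upwards [hCA, hSp, hslog.eventually_lt_const hδ, hSep,
    hNρ.eventually_lt_const (lt_min one_pos hcS), hCD, hE, eventually_gt_atTop 0]
    with n hCA hSp hslog hSep hNρ hCD hE hn α hα q hq
  have hn0 : (0 : ℝ) < n := by exact_mod_cast hn
  have : IsProbabilityMeasure (M n).lawW := by
    rw [← hCD.law_w ⟨0, hn⟩]
    exact Measure.isProbabilityMeasure_map (hCD.measurable_w _).aemeasurable
  have hlmin := hCA.lmin_pos
  have hu0 : 0 ≤ (M n).ucheck cu k := le_min zero_le_one (by positivity)
  have hint := hCA.interlaced hSep hu0 fun hN => by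
    have h1 : (1 : ℝ) ≤ (M n).N := by exact_mod_cast Nat.one_le_iff_ne_zero.2 hN
    have h2 := (M n).one_le_ρ hSep.jump_pos
    have h3 : (M n).ucheck cu k ≤ (M n).N * (M n).ρ * (M n).ucheck cu k :=
      le_mul_of_one_le_left hu0 (one_le_mul_of_one_le_of_one_le h1 h2)
    rw [lt_min_iff, div_lt_iff₀ hlmin, div_lt_iff₀ hlmin, one_mul] at hNρ
    exact ⟨h3.trans_lt hNρ.1, h3.trans_lt hNρ.2⟩
  have hmass : ∀ i : Fin ((M n).Ncheck + 1), (M n).lmin ≤ (M n).lawW.real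
      (ChangePoint.seg (ChangePoint.extendGrid (M n).τcheck i.castSucc)
        (ChangePoint.extendGrid (M n).τcheck i.succ)) := fun i => by
    rw [ChangePoint.real_seg_eq
      (ChangePoint.monotone_extendGrid (M n).monotone_τcheck (Fin.castSucc_le_succ i))]
    exact (hint.gap_check i).le
  have hlmin1 : (M n).lmin ≤ 1 := (hmass 0).trans measureReal_le_one
  set L := Real.log (M n).p with hL
  have hL0 : 0 ≤ L := Real.log_natCast_nonneg _
  have hs1 : (1 : ℝ) ≤ (M n).s := by exact_mod_cast hSp.one_le_s
  have hsL : (M n).s * L ≤ δ * (n * (M n).lmin) := by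
    rw [div_lt_iff₀ (by positivity)] at hslog
    refine hslog.le.trans ?_
    -- Since `l_min ≤ 1` is below a probability, the sparsity condition with `l_min²` implies the
    -- one with `l_min`.
    have : (M n).lmin ^ 2 ≤ (M n).lmin := by nlinarith
    gcongr
  have hLs : L ≤ (M n).s * L := le_mul_of_one_le_left hL0 hs1
  have hnl : 0 < n * (M n).lmin := by positivity
  have hhalf : L ≤ 1 / 2 * (n * (M n).lmin) :=
    hLs.trans (hsL.trans (by gcongr; exact min_le_left _ _))
  have hlog : L / n ≤ 1 := by
    rw [div_le_one hn0]; nlinarith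
  have hn2 : (3 * ((K * (M n).s + 1 : ℕ) : ℝ) + 1) * L ≤ n * (M n).lmin * e := by
    calc (3 * ((K * (M n).s + 1 : ℕ) : ℝ) + 1) * L
        ≤ ((3 * K + 4) * (M n).s) * L := by
          gcongr; push_cast; linarith
      _ = (3 * K + 4) * ((M n).s * L) := by ring
      _ ≤ (3 * K + 4) * (e / (3 * K + 4) * (n * (M n).lmin)) := by
          refine mul_le_mul_of_nonneg_left (hsL.trans ?_) (by positivity)
          gcongr
          exact min_le_right _ _
      _ = _ := by field_simp
  have hkey : ∀ (i : Fin ((M n).Ncheck + 1)) (l : Fin ((M n).N + 1)),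
      (M n).m l.castSucc ≤ i.castSucc → i.succ ≤ (M n).m l.succ →
      (M n).ErrorBound (24 * A / κ) 6 1 ((M n).rate cu k) q (α i) ((M n).β₀ l) := by
    intro i l h1 h2
    have hnear := (hint.nearlyConstant h1 h2).mono (u' := (M n).ucheck cu k) (by
      split_ifs
      · exact hu0
      · exact le_rfl)
    exact hCD.errorBound ha haC hκ hn hcH hA hlog hE hSp hK hlmin (by linarith) hn2 (hmass i)
      hnear (hα i) hq
  refine ⟨fun j i hij => hkey i j ?_ hij.ge, fun i hi => ?_⟩
  · have := hCA.m_strictMono (Fin.castSucc_lt_succ (i := j))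
    rw [hij] at this
    exact Fin.le_castSucc_iff.2 this
  · obtain ⟨l, h1, h2⟩ := ChangePoint.Setup.exists_between hCA.m_zero hCA.m_last hi
    exact ⟨l, hint.isSegmentOf h1 h2, hkey i l h1 h2.le⟩
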